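/- **Data.** For $\mu\in[0,1]$ let $\mathcal P(\mu)$ be the law of $(x,y,a)$ where $y$ is uniform on $\{1,-1\}$, $a\in\{1,-1\}$ with $\Pr(a=y\mid y)=\mu$, and, given $(y,a)$, the input $x=[x_1,x_2,\xi]^\top\in\mathbb R^d$ has independent components $x_1\sim\mathcal N(y,\sigma_1^2)$, $x_2=a$ and $\xi\sim\mathcal N\big(0,\tfrac{\sigma_\xi^2}{d-2}I_{d-2}\big)$. Fix $p\in(\tfrac12,1]$, $s\in[0,1]$, $\lambda>0$, $r>0$, $\sigma_1\ge 0$. **Training.** Let $\mathcal D_{\rm FT}=\{(x_i,y_i,a_i)\}_{i\le n}$ be i.i.d. from $\mathcal P(p)$ and, independently, $\mathcal D_{\rm known}=\{(x'_j,y'_j,a'_j)\}_{j\le m}$ i.i.d. from $\mathcal P(\tfrac12)$. Given these, choose independently for each $i\le n$ an index $J_i$ uniformly from $\{j: y'_j=y_i\}$ (uniformly from $\{1,\dots,m\}$ if this set is empty), and let $\mathcal D_{\rm Mixed}=\{(\tilde x_i,y_i)\}_{i\le n}$ with $\tilde x_i=(1-s)x_i+s\,x'_{J_i}$. Let $w^*$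 be the minimizer over $w\in\mathbb R^d$ of $$\frac1n\sum_{i=1}^n(\tilde x_i^\top w-y_i)^2+\lambda\|w\|^2 ,$$ and let $\mathcal L^{test}_{wg}(w)=\mathbb E\big[(x^\top w-y)^2\mid a\ne y\big]$ for $(x,y,a)\sim\mathcal P(\mu)$; this is the same for every $\mu\in[0,1)$. **Claim.** Let $q=\frac{\lambda}{s^2r+\lambda}$ and $$\begin{aligned} \psi_1&=(1-s)^2(1+\sigma_1^2)+2s(1-s)q+s^2q(1+\sigma_1^2)-(1-s)^2(1-q)+\lambda,\\ \psi_2&=(1-s)^2(2p-1)+s(1-s)q(2p-1)-(1-s)^2(1-q)(2p-1),\\ \psi_3&=(1-s)^2+s^2q-(1-s)^2(1-q)(2p-1)^2+\lambda,\\ \mathcal L_\infty&=\Big(\tfrac{q}{\psi_1\psi_3-\psi_2^2}\big(\psi_3+\psi_2-(\psi_1+\psi_2)(1-s)(2p-1)\big)-1\Big)^2+\sigma_1^2\Big(\tfrac{q}{\psi_1\psi_3-\psi_2^2}\big(\psi_3-\psi_2(1-s)(2p-1)\big)\Big)^2 . \end{aligned}$$ Along every sequence $(n_k,d_k,m_k,\sigma_{\xi,k})$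 with $n_k,d_k,m_k\to\infty$, $n_k/d_k\to\infty$, $d_k/m_k\to\infty$ and $\sigma_{\xi,k}^2/m_k=r$ for all $k$, one has $\mathcal L^{test}_{wg}(w^*)\to\mathcal L_\infty$ in probability. If moreover $\sum_k\big(\tfrac1{m_k}+\tfrac{m_k}{d_k}+\tfrac{d_k}{n_k}\big)<\infty$, then, for training runs defined on a common probability space with an arbitrary joint law, the convergence is almost sure. -/

import Mathlib

open MeasureTheory ProbabilityTheory Filter
open scoped NNReal ENNReal Topology

namespace Dispel

noncomputable section

/-- Labels and spurious attributes live in `{1, -1}`, coded by `Bool`: `true` is `1`, `false` is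
`-1`. -/
def sgn (b : Bool) : ℝ := if b then 1 else -1

/-- An example `(x, y, a)`: input in `ℝ^d`, label, spurious attribute. -/
abbrev Example (d : ℕ) : Type := (Fin d → ℝ) × Bool × Bool

/-- The input `x` of an example. -/
abbrev Example.input {d : ℕ} (e : Example d) : Fin d → ℝ := e.1

/-- The label `y` of an example. -/
abbrev Example.label {d : ℕ} (e : Example d) : Bool := e.2.1

/-- The spurious attribute `a` of an example. -/
abbrev Example.attr {d : ℕ} (e : Example d) : Bool := e.2.2

/-- Mean of the coordinates of `x` given `y` and `a`: `(y, a, 0, …, 0)`. -/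
def coordMean {d : ℕ} (y a : Bool) (i : Fin d) : ℝ :=
  if (i : ℕ) = 0 then sgn y else if (i : ℕ) = 1 then sgn a else 0

/-- Variance of the coordinates of `x` given `y` and `a`:
`(σ₁², σ₂², σξ² / (d - 2), …, σξ² / (d - 2))`. -/
def coordVar {d : ℕ} (σ₁ σ₂ σξ : ℝ≥0) (i : Fin d) : ℝ≥0 :=
  if (i : ℕ) = 0 then σ₁ ^ 2 else if (i : ℕ) = 1 then σ₂ ^ 2 else σξ ^ 2 / ((d - 2 : ℕ) : ℝ≥0)

/-- The law of the input `x` given `y` and `a`: independent Gaussian coordinates. A Gaussian of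
variance `0` is the point mass at its mean. -/
def inputLaw (d : ℕ) (σ₁ σ₂ σξ : ℝ≥0) (y a : Bool) : Measure (Fin d → ℝ) :=
  Measure.pi fun i => gaussianReal (coordMean y a i) (coordVar σ₁ σ₂ σξ i)

/-- The distribution `P(μ)`: `y` is uniform, `a = y` with probability `μ`, and `x` has law
`inputLaw` given `y` and `a`. -/
def dataLaw (d : ℕ) (σ₁ σ₂ σξ : ℝ≥0) (μ : ℝ) : Measure (Example d) :=
  ∑ y : Bool, ∑ a : Bool, ENNReal.ofReal (1 / 2 * if a = y then μ else 1 - μ) •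
    (inputLaw d σ₁ σ₂ σξ y a).prod (Measure.dirac (y, a))

/-- Given the labels `y` of the `n` fine-tuning examples and the labels `y'` of the `m` known
examples, the law of the indices of the known examples that are selected: independently for each
`i`, uniform on the known examples with label `y i`, or on all of them if there are none. -/
def selectLaw {n m : ℕ} (y : Fin n → Bool) (y' : Fin m → Bool) : Measure (Fin n → Fin m) :=
  open scoped Classical in
  Measure.pi fun i =>
    if ∃ j, y' j = y i then uniformOn {j | y' j = y i} else uniformOn Set.univ

/-- `selectLaw` as a kernel. -/
def selectKernel (n m : ℕ) : Kernel ((Fin n → Bool) × (Fin m → Bool)) (Fin n → Fin m) :=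
  Kernel.ofFunOfCountable fun ys => selectLaw ys.1 ys.2

/-- A fine-tuning data set of size `n` and a known data set of size `m`. -/
abbrev DataSets (n d m : ℕ) : Type := (Fin n → Example d) × (Fin m → Example d)

/-- The labels in the two data sets. -/
def labels {n d m : ℕ} (D : DataSets n d m) : (Fin n → Bool) × (Fin m → Bool) :=
  (fun i => (D.1 i).label, fun j => (D.2 j).label)

lemma measurable_labels {n d m : ℕ} : Measurable (labels : DataSets n d m → _) := by
  unfold labels Example.label
  fun_prop

/-- All the randomness of one training run: the two data sets, and for each fine-tuning example
the index of the known example it is mixed with. -/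
abbrev Trial (n d m : ℕ) : Type := DataSets n d m × (Fin n → Fin m)

/-- The law of a training run: `n` i.i.d. examples from `P(p)`, independently `m` i.i.d. examples
from `P(1/2)`, and then the random selection given the labels. -/
def trialLaw (n d m : ℕ) (σ₁ σ₂ σξ : ℝ≥0) (p : ℝ) : Measure (Trial n d m) :=
  ((Measure.pi fun _ : Fin n => dataLaw d σ₁ σ₂ σξ p).prod
    (Measure.pi fun _ : Fin m => dataLaw d σ₁ σ₂ σξ (1 / 2))) ⊗ₘ
    ((selectKernel n m).comap labels measurable_labels)

/-- The `i`-th input of the mixed data set (every example is mixed); its label is that of the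
`i`-th fine-tuning example. -/
def mixedInput {n d m : ℕ} (s : ℝ) (T : Trial n d m) (i : Fin n) : Fin d → ℝ :=
  (1 - s) • (T.1.1 i).input + s • (T.1.2 (T.2 i)).input

/-- Mean squared error on the mixed data set plus the squared Euclidean norm times `lam`. -/
def trainLoss {n d m : ℕ} (s lam : ℝ) (T : Trial n d m) (w : Fin d → ℝ) : ℝ :=
  (∑ i, (mixedInput s T i ⬝ᵥ w - sgn (T.1.1 i).label) ^ 2) / n + lam * ∑ l, w l ^ 2

/-- Worst-group test loss of `w`: the expectation of `(xᵀw - y)²` under `P(μ)` given `a ≠ y`. -/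
def testLoss (d : ℕ) (σ₁ σ₂ σξ : ℝ≥0) (μ : ℝ) (w : Fin d → ℝ) : ℝ :=
  ∫ e, (e.input ⬝ᵥ w - sgn e.label) ^ 2
    ∂(cond (dataLaw d σ₁ σ₂ σξ μ) {e : Example d | e.attr ≠ e.label})

def q (s r lam : ℝ) : ℝ := lam / (s ^ 2 * r + lam)

def ψ₁ (s r lam σ₁ : ℝ) : ℝ :=
  (1 - s) ^ 2 * (1 + σ₁ ^ 2) + 2 * s * (1 - s) * q s r lam + s ^ 2 * q s r lam * (1 + σ₁ ^ 2)
    - (1 - s) ^ 2 * (1 - q s r lam) + lam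

def ψ₂ (s p r lam : ℝ) : ℝ :=
  (1 - s) ^ 2 * (2 * p - 1) + s * (1 - s) * q s r lam * (2 * p - 1)
    - (1 - s) ^ 2 * (1 - q s r lam) * (2 * p - 1)

def ψ₃ (s p r lam : ℝ) : ℝ :=
  (1 - s) ^ 2 + s ^ 2 * q s r lam - (1 - s) ^ 2 * (1 - q s r lam) * (2 * p - 1) ^ 2 + lam

/-- The closed form of the limiting worst-group test loss. -/
def limitLoss (s p r lam σ₁ : ℝ) : ℝ :=
  let q := q s r lam
  let ψ₁ := ψ₁ s r lam σ₁
  let ψ₂ := ψ₂ s p r lam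
  let ψ₃ := ψ₃ s p r lam
  (q / (ψ₁ * ψ₃ - ψ₂ ^ 2) * (ψ₃ + ψ₂ - (ψ₁ + ψ₂) * (1 - s) * (2 * p - 1)) - 1) ^ 2
    + σ₁ ^ 2 * (q / (ψ₁ * ψ₃ - ψ₂ ^ 2) * (ψ₃ - ψ₂ * (1 - s) * (2 * p - 1))) ^ 2

end

end Dispel

namespace Dispel

/-! ### Functions with moments of all orders -/

/-- A real function with finite absolute moments of all orders. -/
@[fun_prop]
def HasMoments {Ω : Type*} [MeasurableSpace Ω] (f : Ω → ℝ) (P : Measure Ω) : Prop :=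
  ∀ p : ℝ≥0∞, p ≠ ∞ → MemLp f p P

namespace HasMoments

variable {Ω : Type*} [MeasurableSpace Ω] {P : Measure Ω} {f g : Ω → ℝ}

theorem integrable (hf : HasMoments f P) : Integrable f P :=
  memLp_one_iff_integrable.1 (hf 1 ENNReal.one_ne_top)

@[fun_prop]
theorem const [IsFiniteMeasure P] (c : ℝ) : HasMoments (fun _ : Ω => c) P :=
  fun _ _ => memLp_const c

@[fun_prop]
theorem add (hf : HasMoments f P) (hg : HasMoments g P) : HasMoments (fun x => f x + g x) P :=
  fun p hp => (hf p hp).add (hg p hp)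

@[fun_prop]
theorem sub (hf : HasMoments f P) (hg : HasMoments g P) : HasMoments (fun x => f x - g x) P :=
  fun p hp => (hf p hp).sub (hg p hp)

@[fun_prop]
theorem neg (hf : HasMoments f P) : HasMoments (fun x => - f x) P :=
  fun p hp => (hf p hp).neg

@[fun_prop]
theorem mul (hf : HasMoments f P) (hg : HasMoments g P) : HasMoments (fun x => f x * g x) P := by
  intro p hp
  have : ENNReal.HolderTriple (2 * p) (2 * p) p := ⟨by
    rw [ENNReal.mul_inv (by simp) (by simp), ← add_mul, ENNReal.inv_two_add_inv_two, one_mul]⟩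
  have h2 : (2 * p) ≠ ∞ := ENNReal.mul_ne_top (by simp) hp
  exact MemLp.mul' (hg _ h2) (hf _ h2)

@[fun_prop]
theorem div_const (hf : HasMoments f P) (c : ℝ) : HasMoments (fun x => f x / c) P := by
  simp_rw [div_eq_mul_inv]
  exact fun p hp => (hf p hp).mul_const _

@[fun_prop]
theorem pow [IsFiniteMeasure P] (hf : HasMoments f P) (k : ℕ) :
    HasMoments (fun x => f x ^ k) P := by
  induction k with
  | zero => simp only [pow_zero]; exact const 1
  | succ k ih => simp_rw [pow_succ]; exact ih.mul hf

@[fun_prop]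
theorem sum {κ : Type*} (S : Finset κ) {F : κ → Ω → ℝ}
    (hF : ∀ i, HasMoments (F i) P) : HasMoments (fun x => ∑ i ∈ S, F i x) P :=
  fun p hp => memLp_finsetSum S fun i _ => hF i p hp

end HasMoments

/-- `(f + g)² ≤ 2 f² + 2 g²` in the mean. -/
theorem integral_add_sq_le {Ω : Type*} [MeasurableSpace Ω] {P : Measure Ω} [IsFiniteMeasure P]
    {f g : Ω → ℝ} (hf : HasMoments f P) (hg : HasMoments g P) :
    ∫ x, (f x + g x) ^ 2 ∂P ≤ 2 * ∫ x, f x ^ 2 ∂P + 2 * ∫ x, g x ^ 2 ∂P := by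
  rw [← integral_const_mul, ← integral_const_mul, ← integral_add
    (HasMoments.integrable (by fun_prop)) (HasMoments.integrable (by fun_prop))]
  refine integral_mono (HasMoments.integrable (by fun_prop))
    (HasMoments.integrable (by fun_prop)) fun x => ?_
  simp only
  nlinarith [sq_nonneg (f x - g x)]

/-- A measure on the line with moments of all orders. -/
class AllMoments (μ : Measure ℝ) : Prop where
  hasMoments_id : HasMoments (fun x => x) μ

section Product

variable {ι : Type*} [Fintype ι] (μ : ι → Measure ℝ) [∀ i, IsProbabilityMeasure (μ i)]

@[fun_prop]
theorem HasMoments.eval [∀ i, AllMoments (μ i)] (k : ι) :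
    HasMoments (fun x : ι → ℝ => x k) (Measure.pi μ) := fun p hp =>
  (AllMoments.hasMoments_id p hp).comp_measurePreserving (measurePreserving_eval μ k)

/-- Functions of disjoint sets of coordinates are uncorrelated under a product measure. -/
theorem integral_mul_of_dependsOn {ι : Type*} [Fintype ι] {X : ι → Type*}
    [∀ i, MeasurableSpace (X i)] (μ : ∀ i, Measure (X i)) [∀ i, IsProbabilityMeasure (μ i)]
    (S : Set ι) {F G : (∀ i, X i) → ℝ} (hF : DependsOn F S) (hG : DependsOn G Sᶜ) :
    ∫ x, F x * G x ∂Measure.pi μ = (∫ x, F x ∂Measure.pi μ) * ∫ x, G x ∂Measure.pi μ := by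
  classical
  have : Nonempty (∀ i, X i) := ⟨fun i => (μ i).nonempty_of_neZero.some⟩
  obtain ⟨x₀⟩ := this
  let e := MeasurableEquiv.piEquivPiSubtypeProd X (· ∈ S)
  have he := measurePreserving_piEquivPiSubtypeProd μ (· ∈ S)
  have hFe : ∀ y, F (e.symm y) = F (e.symm (y.1, (e x₀).2)) := fun y => hF fun i hi => by
    simp [e, MeasurableEquiv.piEquivPiSubtypeProd, Equiv.piEquivPiSubtypeProd, hi]
  have hGe : ∀ y, G (e.symm y) = G (e.symm ((e x₀).1, y.2)) := fun y => hG fun i hi => by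
    have hi' : i ∉ S := hi
    simp [e, MeasurableEquiv.piEquivPiSubtypeProd, Equiv.piEquivPiSubtypeProd, hi']
  have key : ∀ H : (∀ i, X i) → ℝ, ∫ x, H x ∂Measure.pi μ = ∫ y, H (e.symm y)
      ∂((Measure.pi fun i : {i // i ∈ S} => μ i).prod (Measure.pi fun i : {i // i ∉ S} => μ i)) :=
    fun H => by
      rw [← he.integral_comp']
      simp [e]
  rw [key, key F, key G]
  simp_rw [hFe, hGe]
  rw [integral_prod_mul (fun y => F (e.symm (y, (e x₀).2))) (fun y => G (e.symm ((e x₀).1, y)))]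
  congr 1
  · simpa using (integral_prod_mul (μ := Measure.pi fun i : {i // i ∈ S} => μ i)
      (ν := Measure.pi fun i : {i // i ∉ S} => μ i)
      (fun y => F (e.symm (y, (e x₀).2))) (fun _ => (1 : ℝ))).symm
  · simpa using (integral_prod_mul (μ := Measure.pi fun i : {i // i ∈ S} => μ i)
      (ν := Measure.pi fun i : {i // i ∉ S} => μ i)
      (fun _ => (1 : ℝ)) (fun y => G (e.symm ((e x₀).1, y)))).symm

theorem integral_comp_eval_pi (k : ι) {φ : ℝ → ℝ} (hφ : Measurable φ) :
    ∫ x : ι → ℝ, φ (x k) ∂Measure.pi μ = ∫ t, φ t ∂μ k := by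
  rw [← (measurePreserving_eval μ k).map_eq,
    integral_map (measurable_pi_apply k).aemeasurable hφ.aestronglyMeasurable]

/-- A function of one coordinate is uncorrelated with every function of the others. -/
theorem integral_eval_mul_of_update [DecidableEq ι] (k : ι) {φ : ℝ → ℝ} (hφ : Measurable φ)
    {f : (ι → ℝ) → ℝ} (hf : ∀ x t, f (Function.update x k t) = f x) :
    ∫ x, φ (x k) * f x ∂Measure.pi μ = (∫ t, φ t ∂μ k) * ∫ x, f x ∂Measure.pi μ := by
  rw [integral_mul_of_dependsOn μ {k} (F := fun x => φ (x k)) (G := f),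
    integral_comp_eval_pi μ k hφ]
  · intro x y h; simp [h k rfl]
  · intro x y h
    rw [← hf x (y k)]
    congr 1
    ext i
    by_cases hi : i = k
    · subst hi; simp
    · simp [hi, h i hi]

end Product

/-- The square of a sum of pairwise orthogonal functions. -/
theorem integral_sq_sum_of_orthogonal {Ω κ : Type*} [MeasurableSpace Ω] {P : Measure Ω}
    [IsFiniteMeasure P]
    (S : Finset κ) {f : κ → Ω → ℝ} (hf : ∀ i, HasMoments (f i) P)
    (h : ∀ i ∈ S, ∀ j ∈ S, i ≠ j → ∫ x, f i x * f j x ∂P = 0) :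
    ∫ x, (∑ i ∈ S, f i x) ^ 2 ∂P = ∑ i ∈ S, ∫ x, f i x ^ 2 ∂P := by
  simp_rw [sq, Finset.sum_mul_sum]
  rw [integral_finsetSum _ fun i _ => HasMoments.integrable (by fun_prop)]
  refine Finset.sum_congr rfl fun i hi => ?_
  rw [integral_finsetSum _ fun j _ => HasMoments.integrable (by fun_prop)]
  rw [Finset.sum_eq_single i (fun j hj hij => h i hi j hj hij.symm) (fun hh => absurd hi hh)]

section Product

variable {ι κ : Type*} [Fintype ι] (μ : ι → Measure ℝ) [∀ i, IsProbabilityMeasure (μ i)]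

/-- The second moment of a linear combination of centred functions of distinct coordinates whose
coefficients do not depend on these coordinates. -/
theorem integral_sq_sum_eval_mul [DecidableEq ι] (S : Finset κ) {e : κ → ι}
    (he : Function.Injective e) {φ : κ → ℝ → ℝ} (hφ : ∀ i, Measurable (φ i))
    (hφm : ∀ i, HasMoments (fun x : ι → ℝ => φ i (x (e i))) (Measure.pi μ))
    (h0 : ∀ i, ∫ t, φ i t ∂μ (e i) = 0) {f : κ → (ι → ℝ) → ℝ}
    (hfm : ∀ i, HasMoments (f i) (Measure.pi μ))
    (hf : ∀ i ∈ S, ∀ j ∈ S, ∀ x t, f i (Function.update x (e j) t) = f i x) :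
    ∫ x, (∑ i ∈ S, φ i (x (e i)) * f i x) ^ 2 ∂Measure.pi μ =
      ∑ i ∈ S, (∫ t, φ i t ^ 2 ∂μ (e i)) * ∫ x, f i x ^ 2 ∂Measure.pi μ := by
  rw [integral_sq_sum_of_orthogonal S (fun i => (hφm i).mul (hfm i))]
  · refine Finset.sum_congr rfl fun i hi => ?_
    rw [← integral_eval_mul_of_update μ (e i) (φ := fun t => φ i t ^ 2) (by fun_prop)]
    · simp_rw [mul_pow]
    · intro x t; rw [hf i hi i hi]
  · intro i hi j hj hij
    have := integral_eval_mul_of_update μ (e i) (hφ i)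
      (f := fun x => f i x * (φ j (x (e j)) * f j x)) (fun x t => by
        rw [hf i hi i hi, hf j hj i hi, Function.update_of_ne (he.ne hij.symm)])
    rw [h0, zero_mul] at this
    rw [← this]
    congr 1; ext x; ring

/-- The expectation of a product of two affine functions of independent variables. -/
theorem integral_affine_mul_affine [∀ i, AllMoments (μ i)] [Fintype κ] {e : κ → ι}
    (he : Function.Injective e)
    {c v : κ → ℝ} (hc : ∀ i, ∫ t, (t - c i) ∂μ (e i) = 0)
    (hv : ∀ i, ∫ t, (t - c i) ^ 2 ∂μ (e i) = v i) (α₀ β₀ : ℝ) (α β : κ → ℝ) :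
    ∫ x : ι → ℝ, (α₀ + ∑ i, α i * (x (e i) - c i)) * (β₀ + ∑ i, β i * (x (e i) - c i))
      ∂Measure.pi μ = α₀ * β₀ + ∑ i, α i * β i * v i := by
  classical
  have hmean : ∀ i, ∫ x : ι → ℝ, (x (e i) - c i) ∂Measure.pi μ = 0 := fun i => by
    rw [integral_comp_eval_pi μ (e i) (φ := fun t => t - c i) (by fun_prop), hc]
  have hcov : ∀ i j, ∫ x : ι → ℝ, (x (e i) - c i) * (x (e j) - c j) ∂Measure.pi μ =
      if i = j then v i else 0 := by
    intro i j
    split_ifs with hij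
    · subst hij
      simp_rw [← sq]
      rw [integral_comp_eval_pi μ (e i) (φ := fun t => (t - c i) ^ 2) (by fun_prop), hv]
    · rw [integral_eval_mul_of_update μ (e i) (φ := fun t => t - c i) (by fun_prop), hc, zero_mul]
      intro x t
      rw [Function.update_of_ne (he.ne (Ne.symm hij))]
  have hlin : ∀ γ : κ → ℝ, ∫ x : ι → ℝ, (∑ i, γ i * (x (e i) - c i)) ∂Measure.pi μ = 0 := by
    intro γ
    rw [integral_finsetSum _ fun i _ => HasMoments.integrable (by fun_prop)]
    simp [integral_const_mul, hmean]
  have hexp : ∀ x : ι → ℝ,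
      (α₀ + ∑ i, α i * (x (e i) - c i)) * (β₀ + ∑ i, β i * (x (e i) - c i)) =
      (α₀ * β₀ + (α₀ * (∑ i, β i * (x (e i) - c i)) + β₀ * ∑ i, α i * (x (e i) - c i))) +
        ∑ i, ∑ j, (α i * β j) * ((x (e i) - c i) * (x (e j) - c j)) := by
    intro x
    have : (∑ i, α i * (x (e i) - c i)) * (∑ i, β i * (x (e i) - c i)) =
        ∑ i, ∑ j, (α i * β j) * ((x (e i) - c i) * (x (e j) - c j)) := by
      rw [Finset.sum_mul_sum]
      exact Finset.sum_congr rfl fun i _ => Finset.sum_congr rfl fun j _ => by ring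
    rw [← this]; ring
  simp_rw [hexp]
  rw [integral_add (HasMoments.integrable (by fun_prop)) (HasMoments.integrable (by fun_prop)),
    integral_add (HasMoments.integrable (by fun_prop)) (HasMoments.integrable (by fun_prop)),
    integral_add (HasMoments.integrable (by fun_prop)) (HasMoments.integrable (by fun_prop)),
    integral_const, integral_const_mul, integral_const_mul, hlin, hlin,
    integral_finsetSum _ fun i _ => HasMoments.integrable (by fun_prop)]
  have : ∀ i, ∫ x : ι → ℝ, ∑ j, (α i * β j) * ((x (e i) - c i) * (x (e j) - c j)) ∂Measure.pi μ =
      α i * β i * v i := by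
    intro i
    rw [integral_finsetSum _ fun i _ => HasMoments.integrable (by fun_prop)]
    simp [integral_const_mul, hcov]
  simp [this]

end Product

/-- A sum of functions that are uncorrelated unless they have the same label. -/
theorem integral_sq_sum_le_of_fiber {Ω κ β : Type*} [MeasurableSpace Ω] {P : Measure Ω}
    [IsFiniteMeasure P] [Fintype κ] [Fintype β] [DecidableEq β] (J : κ → β) {f : κ → Ω → ℝ}
    (hf : ∀ i, HasMoments (f i) P)
    (h : ∀ i j, J i ≠ J j → ∫ x, f i x * f j x ∂P = 0) {V : ℝ} (hV : ∀ i, ∫ x, f i x ^ 2 ∂P ≤ V) :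
    ∫ x, (∑ i, f i x) ^ 2 ∂P ≤
      V * ∑ b, ((Finset.univ.filter fun i => J i = b).card : ℝ) ^ 2 := by
  have hle : ∀ i j, ∫ x, f i x * f j x ∂P ≤ if J i = J j then V else 0 := by
    intro i j
    split_ifs with hij
    · calc ∫ x, f i x * f j x ∂P ≤ ∫ x, (f i x ^ 2 / 2 + f j x ^ 2 / 2) ∂P := by
            refine integral_mono (HasMoments.integrable (by fun_prop))
              (HasMoments.integrable (by fun_prop)) fun x => ?_
            simp only
            nlinarith [sq_nonneg (f i x - f j x)]
        _ = (∫ x, f i x ^ 2 ∂P) / 2 + (∫ x, f j x ^ 2 ∂P) / 2 := by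
            rw [integral_add (HasMoments.integrable (by fun_prop))
              (HasMoments.integrable (by fun_prop)), integral_div, integral_div]
        _ ≤ V := by linarith [hV i, hV j]
    · exact (h i j hij).le
  simp_rw [sq, Finset.sum_mul_sum]
  rw [integral_finsetSum _ fun i _ => HasMoments.integrable (by fun_prop)]
  have : ∀ i, ∫ x, ∑ j, f i x * f j x ∂P ≤ ∑ j, if J i = J j then V else 0 := fun i => by
    rw [integral_finsetSum _ fun i _ => HasMoments.integrable (by fun_prop)]
    exact Finset.sum_le_sum fun j _ => hle i j
  refine (Finset.sum_le_sum fun i _ => this i).trans (le_of_eq ?_)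
  have hcard : ∀ b, ((Finset.univ.filter fun i => J i = b).card : ℝ) =
      ∑ i, if J i = b then (1 : ℝ) else 0 := fun b => by simp
  simp_rw [hcard, Finset.sum_mul_sum, Finset.mul_sum]
  rw [Finset.sum_comm]
  conv_rhs => rw [Finset.sum_comm]
  rw [Finset.sum_comm]
  refine Finset.sum_congr rfl fun i _ => ?_
  rw [Finset.sum_comm]
  refine Finset.sum_congr rfl fun j _ => ?_
  simp [eq_comm]

noncomputable section

/-! ### Second moments for fixed selection indices -/

/-- Indices of the coordinates of all the inputs: `Sum.inl i` is the `i`-th fine-tuning example and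
`Sum.inr j` the `j`-th known example. -/
abbrev CoordIdx (n m D : ℕ) : Type := (Fin n ⊕ Fin m) × Fin (D + 2)

/-- The moments of the coordinates of the inputs multiplied by their labels: a mean-one coordinate of
variance `v`, a coordinate with values `±1` of mean `ρ` (fine-tuning) or `0` (known), and centred noise
of variance `τ`. -/
structure CoordMoments {n m D : ℕ} (μ : CoordIdx n m D → Measure ℝ) (v τ ρ K : ℝ) : Prop where
  fst_mean : ∀ b, ∫ t, (t - 1) ∂μ (b, 0) = 0
  fst_var : ∀ b, ∫ t, (t - 1) ^ 2 ∂μ (b, 0) = v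
  fst_fourth : ∀ b, ∫ t, t ^ 4 ∂μ (b, 0) ≤ K
  snd_mean_left : ∀ i, ∫ t, (t - ρ) ∂μ (Sum.inl i, 1) = 0
  snd_var_left : ∀ i, ∫ t, (t - ρ) ^ 2 ∂μ (Sum.inl i, 1) = 1 - ρ ^ 2
  snd_mean_right : ∀ j, ∫ t, (t - 0) ∂μ (Sum.inr j, 1) = 0
  snd_var_right : ∀ j, ∫ t, (t - 0) ^ 2 ∂μ (Sum.inr j, 1) = 1
  snd_fourth : ∀ b, ∫ t, t ^ 4 ∂μ (b, 1) ≤ K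
  noise_mean : ∀ b (l : Fin D), ∫ t, t ∂μ (b, l.succ.succ) = 0
  noise_var : ∀ b (l : Fin D), ∫ t, t ^ 2 ∂μ (b, l.succ.succ) = τ
  noise_fourth : ∀ b (l : Fin D), ∫ t, (t ^ 2 - τ) ^ 2 ∂μ (b, l.succ.succ) ≤ K * τ ^ 2

/-- The constants that enter the comparison vector: `a` and `b` are its first two coordinates. -/
structure Params where
  (s ρ a b q κ : ℝ)

namespace Params

variable {n m D : ℕ} (θ : Params)

/-- The centred part of the residual coming from a fine-tuning example. -/
def resFt (i : Fin n) (x : CoordIdx n m D → ℝ) : ℝ :=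
  (1 - θ.s) * (θ.a * (x (Sum.inl i, 0) - 1) + θ.b * (x (Sum.inl i, 1) - θ.ρ))

/-- The constant part of `resKnown`. -/
def offset : ℝ := θ.a + (1 - θ.s) * θ.ρ * θ.b - 1

/-- The part of the residual determined by the first two coordinates of a known example. -/
def resKnown (j : Fin m) (x : CoordIdx n m D → ℝ) : ℝ :=
  θ.offset + θ.s * (θ.a * (x (Sum.inr j, 0) - 1) + θ.b * x (Sum.inr j, 1))

/-- The noise coordinates of the comparison vector. -/
def noiseWeight (l : Fin D) (x : CoordIdx n m D → ℝ) : ℝ :=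
  -(θ.κ / m) * ∑ j, x (Sum.inr j, l.succ.succ) * θ.resKnown j x

/-- The main part of the residual of the comparison vector. -/
def mainRes (J : Fin n → Fin m) (i : Fin n) (x : CoordIdx n m D → ℝ) : ℝ :=
  θ.resFt i x + θ.q * θ.resKnown (J i) x

/-- The contribution of the fine-tuning noise to the residual. -/
def errFt (i : Fin n) (x : CoordIdx n m D → ℝ) : ℝ :=
  (1 - θ.s) * ∑ l : Fin D, x (Sum.inl i, l.succ.succ) * θ.noiseWeight l x

/-- The deviation of the contribution of the known noise to the residual from its limit. -/
def errKnown (j : Fin m) (x : CoordIdx n m D → ℝ) : ℝ :=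
  θ.s * (∑ l : Fin D, x (Sum.inr j, l.succ.succ) * θ.noiseWeight l x) +
    (1 - θ.q) * θ.resKnown j x

/-- Second moment of `resFt`. -/
def varFt (v : ℝ) : ℝ := (1 - θ.s) ^ 2 * (θ.a ^ 2 * v + θ.b ^ 2 * (1 - θ.ρ ^ 2))

/-- Second moment of `resKnown`. -/
def sqKnown (v : ℝ) : ℝ := θ.offset ^ 2 + θ.s ^ 2 * (θ.a ^ 2 * v + θ.b ^ 2)

section Update

variable (b : Fin n ⊕ Fin m) (l : Fin D) (x : CoordIdx n m D → ℝ) (t : ℝ)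

@[simp]
theorem resFt_update (i : Fin n) :
    θ.resFt i (Function.update x (b, l.succ.succ) t) = θ.resFt i x := by
  simp [resFt, Prod.ext_iff, Fin.ext_iff]

@[simp]
theorem resKnown_update (j : Fin m) :
    θ.resKnown j (Function.update x (b, l.succ.succ) t) = θ.resKnown j x := by
  simp [resKnown, Prod.ext_iff, Fin.ext_iff]

@[simp]
theorem mainRes_update (J : Fin n → Fin m) (i : Fin n) :
    θ.mainRes J i (Function.update x (b, l.succ.succ) t) = θ.mainRes J i x := by
  simp [mainRes]

@[simp]
theorem noiseWeight_update_inl (i : Fin n) (l' : Fin D) :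
    θ.noiseWeight l' (Function.update x (Sum.inl i, l.succ.succ) t) = θ.noiseWeight l' x := by
  simp [noiseWeight]

end Update

section Moments

variable {μ : CoordIdx n m D → Measure ℝ} [∀ k, IsProbabilityMeasure (μ k)]
  [∀ k, AllMoments (μ k)] {v τ ρ K : ℝ}

@[fun_prop]
theorem hasMoments_resFt (i : Fin n) : HasMoments (θ.resFt i) (Measure.pi μ) := by
  unfold resFt; fun_prop

@[fun_prop]
theorem hasMoments_resKnown (j : Fin m) : HasMoments (θ.resKnown j) (Measure.pi μ) := by
  unfold resKnown; fun_prop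

@[fun_prop]
theorem hasMoments_mainRes (J : Fin n → Fin m) (i : Fin n) :
    HasMoments (θ.mainRes J i) (Measure.pi μ) := by
  unfold mainRes; fun_prop

@[fun_prop]
theorem hasMoments_noiseWeight (l : Fin D) : HasMoments (θ.noiseWeight l) (Measure.pi μ) := by
  unfold noiseWeight; fun_prop

@[fun_prop]
theorem hasMoments_errFt (i : Fin n) : HasMoments (θ.errFt i) (Measure.pi μ) := by
  unfold errFt; fun_prop

@[fun_prop]
theorem hasMoments_errKnown (j : Fin m) : HasMoments (θ.errKnown j) (Measure.pi μ) := by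
  unfold errKnown; fun_prop

theorem integral_resFt_mul (h : CoordMoments μ v τ θ.ρ K) (i i' : Fin n) :
    ∫ x, θ.resFt i x * θ.resFt i' x ∂Measure.pi μ = if i = i' then θ.varFt v else 0 := by
  split_ifs with hii
  · subst hii
    have := integral_affine_mul_affine μ (e := ![(Sum.inl i, 0), (Sum.inl i, 1)])
      (c := ![1, θ.ρ]) (v := ![v, 1 - θ.ρ ^ 2])
      (fun k l hkl => by fin_cases k <;> fin_cases l <;> simp_all)
      (fun k => by fin_cases k; exacts [h.fst_mean _, h.snd_mean_left _])
      (fun k => by fin_cases k; exacts [h.fst_var _, h.snd_var_left _]) 0 0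
      ![(1 - θ.s) * θ.a, (1 - θ.s) * θ.b] ![(1 - θ.s) * θ.a, (1 - θ.s) * θ.b]
    simp only [Fin.sum_univ_two] at this
    simp at this
    rw [varFt]
    convert this using 1
    · congr 1; ext x; simp only [resFt]; ring
    · ring
  · have := integral_affine_mul_affine μ
      (e := ![(Sum.inl i, 0), (Sum.inl i, 1), (Sum.inl i', 0), (Sum.inl i', 1)])
      (c := ![1, θ.ρ, 1, θ.ρ]) (v := ![v, 1 - θ.ρ ^ 2, v, 1 - θ.ρ ^ 2])
      (fun k l hkl => by
        have := Ne.symm hii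
        fin_cases k <;> fin_cases l <;> simp_all)
      (fun k => by
        fin_cases k
        exacts [h.fst_mean _, h.snd_mean_left _, h.fst_mean _, h.snd_mean_left _])
      (fun k => by
        fin_cases k
        exacts [h.fst_var _, h.snd_var_left _, h.fst_var _, h.snd_var_left _]) 0 0
      ![(1 - θ.s) * θ.a, (1 - θ.s) * θ.b, 0, 0] ![0, 0, (1 - θ.s) * θ.a, (1 - θ.s) * θ.b]
    simp only [Fin.sum_univ_four] at this
    simp at this
    rw [← this]
    congr 1; ext x; simp only [resFt]; ring

theorem integral_resFt_sq (h : CoordMoments μ v τ θ.ρ K) (i : Fin n) :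
    ∫ x, θ.resFt i x ^ 2 ∂Measure.pi μ = θ.varFt v := by
  simp_rw [sq]
  rw [θ.integral_resFt_mul h, if_pos rfl]

theorem integral_resKnown_sq (h : CoordMoments μ v τ θ.ρ K) (j : Fin m) :
    ∫ x, θ.resKnown j x ^ 2 ∂Measure.pi μ = θ.sqKnown v := by
  have := integral_affine_mul_affine μ (e := ![(Sum.inr j, 0), (Sum.inr j, 1)])
    (c := ![1, 0]) (v := ![v, 1]) (fun k l hkl => by fin_cases k <;> fin_cases l <;> simp_all)
    (fun k => by fin_cases k; exacts [h.fst_mean _, h.snd_mean_right _])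
    (fun k => by fin_cases k; exacts [h.fst_var _, h.snd_var_right _]) θ.offset θ.offset
    ![θ.s * θ.a, θ.s * θ.b] ![θ.s * θ.a, θ.s * θ.b]
  simp only [Fin.sum_univ_two] at this
  simp at this
  rw [sqKnown]
  convert this using 1
  · congr 1; ext x; simp only [resKnown]; ring
  · ring

theorem varFt_nonneg (h : CoordMoments μ v τ θ.ρ K) (i : Fin n) : 0 ≤ θ.varFt v := by
  rw [← θ.integral_resFt_sq h i]; exact integral_nonneg fun _ => sq_nonneg _

theorem sqKnown_nonneg (h : CoordMoments μ v τ θ.ρ K) (j : Fin m) : 0 ≤ θ.sqKnown v := by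
  rw [← θ.integral_resKnown_sq h j]; exact integral_nonneg fun _ => sq_nonneg _

theorem integral_sum_resFt_sq (h : CoordMoments μ v τ θ.ρ K) (S : Finset (Fin n)) :
    ∫ x, (∑ i ∈ S, θ.resFt i x) ^ 2 ∂Measure.pi μ = S.card * θ.varFt v := by
  rw [integral_sq_sum_of_orthogonal S (fun i => by fun_prop)]
  · simp [θ.integral_resFt_sq h]
  · intro i _ j _ hij
    rw [θ.integral_resFt_mul h, if_neg hij]

theorem integral_mainRes_sq_le (h : CoordMoments μ v τ θ.ρ K) (J : Fin n → Fin m) (i : Fin n) :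
    ∫ x, θ.mainRes J i x ^ 2 ∂Measure.pi μ ≤ 2 * θ.varFt v + 2 * θ.q ^ 2 * θ.sqKnown v := by
  rw [← θ.integral_resFt_sq h i, ← θ.integral_resKnown_sq h (J i), ← integral_const_mul,
    ← integral_const_mul, ← integral_add (HasMoments.integrable (by fun_prop))
      (HasMoments.integrable (by fun_prop))]
  refine integral_mono (HasMoments.integrable (by fun_prop))
    (HasMoments.integrable (by fun_prop)) fun x => ?_
  simp only [mainRes]
  nlinarith [sq_nonneg (θ.resFt i x - θ.q * θ.resKnown (J i) x)]

/-- Linear forms in the noise with coefficients that do not depend on that noise. -/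
theorem integral_noise_sum_sq {κ : Type*} (h : CoordMoments μ v τ ρ K) (S : Finset κ)
    {e : κ → (Fin n ⊕ Fin m) × Fin D} (he : Function.Injective e)
    {f : κ → (CoordIdx n m D → ℝ) → ℝ} (hfm : ∀ i, HasMoments (f i) (Measure.pi μ))
    (hf : ∀ i ∈ S, ∀ j ∈ S, ∀ x t,
      f i (Function.update x ((e j).1, (e j).2.succ.succ) t) = f i x) :
    ∫ x, (∑ i ∈ S, x ((e i).1, (e i).2.succ.succ) * f i x) ^ 2 ∂Measure.pi μ =
      τ * ∑ i ∈ S, ∫ x, f i x ^ 2 ∂Measure.pi μ := by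
  have := integral_sq_sum_eval_mul μ S (e := fun i => ((e i).1, (e i).2.succ.succ))
    (fun i j hij => he (by simpa [Prod.ext_iff] using hij)) (φ := fun _ t => t)
    (fun _ => measurable_id) (fun i => by fun_prop) (fun i => h.noise_mean _ _) hfm hf
  rw [this, Finset.mul_sum]
  simp_rw [h.noise_var]

theorem integral_noiseWeight_sq (h : CoordMoments μ v τ θ.ρ K) (l : Fin D) :
    ∫ x, θ.noiseWeight l x ^ 2 ∂Measure.pi μ = (θ.κ / m) ^ 2 * (τ * (m * θ.sqKnown v)) := by
  simp_rw [noiseWeight, mul_pow, neg_sq]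
  rw [integral_const_mul, integral_noise_sum_sq h Finset.univ (e := fun j => (Sum.inr j, l))
    (fun i j hij => by simpa using hij) (fun i => by fun_prop) (fun i _ j _ x t => by simp)]
  simp [θ.integral_resKnown_sq h]

theorem integral_errFt_sq (h : CoordMoments μ v τ θ.ρ K) (i : Fin n) :
    ∫ x, θ.errFt i x ^ 2 ∂Measure.pi μ =
      (1 - θ.s) ^ 2 * (τ * (D * ((θ.κ / m) ^ 2 * (τ * (m * θ.sqKnown v))))) := by
  simp_rw [errFt, mul_pow]
  rw [integral_const_mul, integral_noise_sum_sq h Finset.univ (e := fun l => (Sum.inl i, l))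
    (fun i j hij => by simpa using hij) (fun i => by fun_prop) (fun i _ j _ x t => by simp)]
  simp [θ.integral_noiseWeight_sq h]

end Moments

end Params

/-- The fraction of the fine-tuning examples that are mixed with the `j`-th known example. -/
def freq {n m : ℕ} (J : Fin n → Fin m) (j : Fin m) : ℝ :=
  ((Finset.univ.filter fun i => J i = j).card : ℝ) / n

/-- The squared distance between the selection frequencies and the uniform distribution. -/
def freqDev {n m : ℕ} (J : Fin n → Fin m) : ℝ := ∑ j, (freq J j - 1 / m) ^ 2

theorem sum_card_fiber {n m : ℕ} (J : Fin n → Fin m) :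
    ∑ j, ((Finset.univ.filter fun i => J i = j).card : ℝ) = n := by
  have := Finset.card_eq_sum_card_fiberwise (f := J) (s := Finset.univ) (t := Finset.univ)
    (fun _ _ => Finset.mem_coe.2 (Finset.mem_univ _))
  rw [Finset.card_univ, Fintype.card_fin] at this
  exact_mod_cast this.symm

theorem sum_freq {n m : ℕ} (hn : 0 < n) (J : Fin n → Fin m) : ∑ j, freq J j = 1 := by
  have : (n : ℝ) ≠ 0 := by positivity
  simp_rw [freq]
  rw [← Finset.sum_div, sum_card_fiber, div_self this]

theorem sum_freq_sq {n m : ℕ} (hn : 0 < n) (hm : 0 < m) (J : Fin n → Fin m) :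
    ∑ j, freq J j ^ 2 = freqDev J + 1 / m := by
  have hm' : (m : ℝ) ≠ 0 := by positivity
  have : freqDev J = ∑ j, (freq J j ^ 2 - 2 / m * freq J j + 1 / m ^ 2) :=
    Finset.sum_congr rfl fun j _ => by ring
  rw [this, Finset.sum_add_distrib, Finset.sum_sub_distrib, ← Finset.mul_sum, sum_freq hn]
  simp
  field_simp
  ring

theorem freqDev_nonneg {n m : ℕ} (J : Fin n → Fin m) : 0 ≤ freqDev J :=
  Finset.sum_nonneg fun _ _ => sq_nonneg _

namespace Params

variable {n m D : ℕ} (θ : Params)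

/-- A noise coordinate of the gradient at the comparison vector, up to `errFt` and `errKnown`. -/
def gradNoise (lam : ℝ) (J : Fin n → Fin m) (l : Fin D) (x : CoordIdx n m D → ℝ) : ℝ :=
  (∑ i, ((1 - θ.s) * x (Sum.inl i, l.succ.succ) + θ.s * x (Sum.inr (J i), l.succ.succ)) *
    θ.mainRes J i x) / n + lam * θ.noiseWeight l x

/-- One of the first two coordinates of the gradient at the comparison vector, up to `errFt` and
`errKnown`. -/
def gradCore (c : ℝ) (J : Fin n → Fin m) (k : Fin (D + 2)) (x : CoordIdx n m D → ℝ) : ℝ :=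
  (∑ i, ((1 - θ.s) * x (Sum.inl i, k) + θ.s * x (Sum.inr (J i), k)) * θ.mainRes J i x) / n + c

/-- The coefficient of the `j`-th known noise vector in `gradNoise`. -/
def knownCoeff (J : Fin n → Fin m) (j : Fin m) (x : CoordIdx n m D → ℝ) : ℝ :=
  (∑ i ∈ Finset.univ.filter fun i => J i = j, θ.resFt i x) / n +
    θ.q * (freq J j - 1 / m) * θ.resKnown j x

theorem gradNoise_eq {lam : ℝ} (hκ : lam * θ.κ = θ.s * θ.q) (J : Fin n → Fin m) (l : Fin D)
    (x : CoordIdx n m D → ℝ) :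
    θ.gradNoise lam J l x =
      (1 - θ.s) * (∑ i, x (Sum.inl i, l.succ.succ) * (θ.mainRes J i x / n)) +
        θ.s * ∑ j, x (Sum.inr j, l.succ.succ) * θ.knownCoeff J j x := by
  have h1 : ∀ j, x (Sum.inr j, l.succ.succ) * θ.knownCoeff J j x =
      (∑ i ∈ Finset.univ.filter fun i => J i = j,
        x (Sum.inr (J i), l.succ.succ) * θ.mainRes J i x) / n -
      θ.q / m * (x (Sum.inr j, l.succ.succ) * θ.resKnown j x) := by
    intro j
    have : ∑ i ∈ Finset.univ.filter (fun i => J i = j),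
        x (Sum.inr (J i), l.succ.succ) * θ.mainRes J i x =
        ∑ i ∈ Finset.univ.filter (fun i => J i = j),
          x (Sum.inr j, l.succ.succ) * (θ.resFt i x + θ.q * θ.resKnown j x) := by
      refine Finset.sum_congr rfl fun i hi => ?_
      rw [Finset.mem_filter] at hi
      rw [mainRes, hi.2]
    rw [this, ← Finset.mul_sum, Finset.sum_add_distrib, knownCoeff, freq]
    simp only [Finset.sum_const, nsmul_eq_mul]
    ring
  simp_rw [h1]
  rw [Finset.sum_sub_distrib, ← Finset.sum_div, Finset.sum_fiberwise, ← Finset.mul_sum, gradNoise,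
    noiseWeight]
  have h2 : ∑ i, ((1 - θ.s) * x (Sum.inl i, l.succ.succ) +
      θ.s * x (Sum.inr (J i), l.succ.succ)) * θ.mainRes J i x =
      (1 - θ.s) * (∑ i, x (Sum.inl i, l.succ.succ) * θ.mainRes J i x) +
        θ.s * ∑ i, x (Sum.inr (J i), l.succ.succ) * θ.mainRes J i x := by
    rw [Finset.mul_sum, Finset.mul_sum, ← Finset.sum_add_distrib]
    exact Finset.sum_congr rfl fun i _ => by ring
  have h3 : ∑ i, x (Sum.inl i, l.succ.succ) * (θ.mainRes J i x / n) =
      (∑ i, x (Sum.inl i, l.succ.succ) * θ.mainRes J i x) / n := by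
    rw [Finset.sum_div]
    exact Finset.sum_congr rfl fun i _ => by ring
  rw [h2, h3]
  linear_combination (-(∑ j, x (Sum.inr j, l.succ.succ) * θ.resKnown j x) / m) * hκ

theorem errKnown_eq (hm : 0 < m) {τ r : ℝ} (hτ : D * τ = r * m) (hκ : θ.s * θ.κ * r = 1 - θ.q)
    (j : Fin m) (x : CoordIdx n m D → ℝ) :
    θ.errKnown j x = -(θ.s * θ.κ / m) *
      ((∑ l : Fin D, (x (Sum.inr j, l.succ.succ) ^ 2 - τ) * θ.resKnown j x) +
        ∑ l : Fin D, x (Sum.inr j, l.succ.succ) *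
          ∑ k ∈ Finset.univ.erase j, x (Sum.inr k, l.succ.succ) * θ.resKnown k x) := by
  have hm' : (m : ℝ) ≠ 0 := by positivity
  rw [errKnown, ← Finset.sum_add_distrib]
  have h1 : ∀ l : Fin D, x (Sum.inr j, l.succ.succ) * θ.noiseWeight l x =
      -(θ.κ / m) * (((x (Sum.inr j, l.succ.succ) ^ 2 - τ) * θ.resKnown j x +
        x (Sum.inr j, l.succ.succ) *
          ∑ k ∈ Finset.univ.erase j, x (Sum.inr k, l.succ.succ) * θ.resKnown k x) +
        τ * θ.resKnown j x) := by
    intro l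
    rw [noiseWeight, ← Finset.add_sum_erase _ _ (Finset.mem_univ j)]
    ring
  simp_rw [h1]
  rw [← Finset.mul_sum, Finset.sum_add_distrib]
  simp only [Finset.sum_const, Finset.card_univ, Fintype.card_fin, nsmul_eq_mul]
  have h2 : θ.s * (θ.κ / m) * (D * τ) = 1 - θ.q := by
    rw [hτ, ← hκ]; field_simp
  linear_combination (-θ.resKnown j x) * h2

section Moments

variable {μ : CoordIdx n m D → Measure ℝ} [∀ k, IsProbabilityMeasure (μ k)]
  [∀ k, AllMoments (μ k)] {v τ ρ K : ℝ}

@[fun_prop]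
theorem hasMoments_knownCoeff (J : Fin n → Fin m) (j : Fin m) :
    HasMoments (θ.knownCoeff J j) (Measure.pi μ) := by
  unfold knownCoeff; fun_prop

@[fun_prop]
theorem hasMoments_gradNoise (lam : ℝ) (J : Fin n → Fin m) (l : Fin D) :
    HasMoments (θ.gradNoise lam J l) (Measure.pi μ) := by
  unfold gradNoise; fun_prop

@[fun_prop]
theorem hasMoments_gradCore (c : ℝ) (J : Fin n → Fin m) (k : Fin (D + 2)) :
    HasMoments (θ.gradCore c J k) (Measure.pi μ) := by
  unfold gradCore; fun_prop

theorem integral_errKnown_sq_le (h : CoordMoments μ v τ θ.ρ K) (hm : 0 < m) {r : ℝ}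
    (hτ : D * τ = r * m) (hκ : θ.s * θ.κ * r = 1 - θ.q) (j : Fin m) :
    ∫ x, θ.errKnown j x ^ 2 ∂Measure.pi μ ≤
      2 * (θ.s * θ.κ / m) ^ 2 * (D * τ ^ 2 * (K + m) * θ.sqKnown v) := by
  have hC := θ.sqKnown_nonneg h j
  simp_rw [θ.errKnown_eq hm hτ hκ, mul_pow, neg_sq]
  rw [integral_const_mul]
  have h1 : ∫ x, (∑ l : Fin D, (x (Sum.inr j, l.succ.succ) ^ 2 - τ) * θ.resKnown j x) ^ 2
      ∂Measure.pi μ ≤ D * (K * τ ^ 2 * θ.sqKnown v) := by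
    rw [integral_sq_sum_eval_mul μ Finset.univ (e := fun l : Fin D => (Sum.inr j, l.succ.succ))
      (fun i j hij => by simpa using hij) (φ := fun _ t => t ^ 2 - τ) (fun _ => by fun_prop)
      (fun _ => by fun_prop) ?_ (fun _ => by fun_prop) (fun _ _ _ _ x t => by simp)]
    · refine (Finset.sum_le_card_nsmul _ _ (K * τ ^ 2 * θ.sqKnown v) fun l _ => ?_).trans
        (by simp)
      rw [θ.integral_resKnown_sq h]
      exact mul_le_mul_of_nonneg_right (h.noise_fourth _ _) hC
    · intro l
      rw [integral_sub (HasMoments.integrable (AllMoments.hasMoments_id.pow 2))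
        (integrable_const _), h.noise_var]
      simp
  have h2 : ∫ x, (∑ l : Fin D, x (Sum.inr j, l.succ.succ) *
      ∑ k ∈ Finset.univ.erase j, x (Sum.inr k, l.succ.succ) * θ.resKnown k x) ^ 2
      ∂Measure.pi μ ≤ τ * (D * (τ * (m * θ.sqKnown v))) := by
    rw [integral_noise_sum_sq h Finset.univ (e := fun l => (Sum.inr j, l))
      (fun i j hij => by simpa using hij) (fun i => by fun_prop) ?_]
    · have : ∀ l : Fin D, ∫ x, (∑ k ∈ Finset.univ.erase j,
          x (Sum.inr k, l.succ.succ) * θ.resKnown k x) ^ 2 ∂Measure.pi μ =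
          τ * ((m - 1 : ℕ) * θ.sqKnown v) := by
        intro l
        rw [integral_noise_sum_sq h (Finset.univ.erase j) (e := fun k => (Sum.inr k, l))
          (fun i j hij => by simpa using hij) (fun i => by fun_prop) (fun i _ j _ x t => by simp)]
        simp [θ.integral_resKnown_sq h]
      simp_rw [this]
      simp only [Finset.sum_const, Finset.card_univ, Fintype.card_fin, nsmul_eq_mul]
      have : ((m - 1 : ℕ) : ℝ) ≤ m := by exact_mod_cast Nat.sub_le m 1
      have h3 : ((m - 1 : ℕ) : ℝ) * θ.sqKnown v ≤ m * θ.sqKnown v := by gcongr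
      have h4 : 0 ≤ (D : ℝ) * τ ^ 2 := by positivity
      nlinarith [mul_le_mul_of_nonneg_left h3 h4]
    · intro l _ l' _ x t
      refine Finset.sum_congr rfl fun k hk => ?_
      rw [Finset.mem_erase] at hk
      rw [Function.update_of_ne (by simp [hk.1]), resKnown_update]
  have h3 := integral_add_sq_le (P := Measure.pi μ)
    (f := fun x => ∑ l : Fin D, (x (Sum.inr j, l.succ.succ) ^ 2 - τ) * θ.resKnown j x)
    (g := fun x => ∑ l : Fin D, x (Sum.inr j, l.succ.succ) *
      ∑ k ∈ Finset.univ.erase j, x (Sum.inr k, l.succ.succ) * θ.resKnown k x)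
    (by fun_prop) (by fun_prop)
  calc _ ≤ (θ.s * θ.κ / m) ^ 2 * (2 * (D * (K * τ ^ 2 * θ.sqKnown v)) +
        2 * (τ * (D * (τ * (m * θ.sqKnown v))))) :=
        mul_le_mul_of_nonneg_left (by linarith) (sq_nonneg _)
    _ = _ := by ring

@[simp]
theorem knownCoeff_update (J : Fin n → Fin m) (j : Fin m) (b : Fin n ⊕ Fin m) (l : Fin D)
    (x : CoordIdx n m D → ℝ) (t : ℝ) :
    θ.knownCoeff J j (Function.update x (b, l.succ.succ) t) = θ.knownCoeff J j x := by
  simp [knownCoeff]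

theorem integral_knownCoeff_sq_le (h : CoordMoments μ v τ θ.ρ K) (J : Fin n → Fin m) (j : Fin m) :
    ∫ x, θ.knownCoeff J j x ^ 2 ∂Measure.pi μ ≤
      2 * (((Finset.univ.filter fun i => J i = j).card : ℝ) * θ.varFt v / n ^ 2) +
        2 * (θ.q ^ 2 * (freq J j - 1 / m) ^ 2 * θ.sqKnown v) := by
  refine (integral_add_sq_le (by fun_prop) (by fun_prop)).trans (le_of_eq ?_)
  simp_rw [div_pow, mul_pow]
  rw [integral_div, integral_const_mul, θ.integral_sum_resFt_sq h, θ.integral_resKnown_sq h]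

theorem integral_gradNoise_sq_le (h : CoordMoments μ v τ θ.ρ K) (hτ : 0 ≤ τ) (hn : 0 < n)
    {lam : ℝ} (hκ : lam * θ.κ = θ.s * θ.q) (J : Fin n → Fin m) (l : Fin D) :
    ∫ x, θ.gradNoise lam J l x ^ 2 ∂Measure.pi μ ≤
      τ * (2 * (1 - θ.s) ^ 2 * ((2 * θ.varFt v + 2 * θ.q ^ 2 * θ.sqKnown v) / n) +
        2 * θ.s ^ 2 * (2 * (θ.varFt v / n) + 2 * (θ.q ^ 2 * freqDev J * θ.sqKnown v))) := by
  have hn' : (n : ℝ) ≠ 0 := by positivity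
  simp_rw [θ.gradNoise_eq hκ]
  refine (integral_add_sq_le (by fun_prop) (by fun_prop)).trans ?_
  simp_rw [mul_pow]
  rw [integral_const_mul, integral_const_mul,
    integral_noise_sum_sq h Finset.univ (e := fun i => (Sum.inl i, l))
      (fun i j hij => by simpa using hij) (fun i => by fun_prop) (fun i _ j _ x t => by simp),
    integral_noise_sum_sq h Finset.univ (e := fun i => (Sum.inr i, l))
      (fun i j hij => by simpa using hij) (fun i => by fun_prop) (fun i _ j _ x t => by simp)]
  have h1 : ∑ i, ∫ x, (θ.mainRes J i x / n) ^ 2 ∂Measure.pi μ ≤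
      (2 * θ.varFt v + 2 * θ.q ^ 2 * θ.sqKnown v) / n := by
    simp_rw [div_pow]
    refine (Finset.sum_le_card_nsmul _ _
      ((2 * θ.varFt v + 2 * θ.q ^ 2 * θ.sqKnown v) / n ^ 2) fun i _ => ?_).trans (le_of_eq ?_)
    · rw [integral_div]
      gcongr
      exact θ.integral_mainRes_sq_le h J i
    · simp; field_simp
  have h2 : ∑ j, ∫ x, θ.knownCoeff J j x ^ 2 ∂Measure.pi μ ≤
      2 * (θ.varFt v / n) + 2 * (θ.q ^ 2 * freqDev J * θ.sqKnown v) := by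
    refine (Finset.sum_le_sum fun j _ => θ.integral_knownCoeff_sq_le h J j).trans (le_of_eq ?_)
    rw [Finset.sum_add_distrib, ← Finset.mul_sum, ← Finset.mul_sum, ← Finset.sum_div,
      ← Finset.sum_mul, ← Finset.sum_mul, ← Finset.mul_sum, sum_card_fiber, freqDev]
    field_simp
  have h3 := mul_le_mul_of_nonneg_left h1 (show 0 ≤ 2 * ((1 - θ.s) ^ 2 * τ) by positivity)
  have h4 := mul_le_mul_of_nonneg_left h2 (show 0 ≤ 2 * (θ.s ^ 2 * τ) by positivity)
  nlinarith [h3, h4]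

end Moments

/-- A coordinate of a mixed input times the main part of the residual. -/
def mixTerm (J : Fin n → Fin m) (k : Fin (D + 2)) (i : Fin n) (x : CoordIdx n m D → ℝ) : ℝ :=
  ((1 - θ.s) * x (Sum.inl i, k) + θ.s * x (Sum.inr (J i), k)) * θ.mainRes J i x

/-- The constant term of `mainRes`. -/
def mainConst : ℝ := θ.q * (θ.offset - θ.s * θ.a) - (1 - θ.s) * (θ.a + θ.b * θ.ρ)

/-- A bound for the second moment of `mixTerm`. -/
def mixBound (K : ℝ) : ℝ :=
  (8 * ((1 - θ.s) ^ 4 + θ.s ^ 4) * K + 512 * ((((1 - θ.s) * θ.a) ^ 4 + ((1 - θ.s) * θ.b) ^ 4 +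
    (θ.q * θ.s * θ.a) ^ 4 + (θ.q * θ.s * θ.b) ^ 4) * K + θ.mainConst ^ 4)) / 2

theorem add_pow_four_le (a b : ℝ) : (a + b) ^ 4 ≤ 8 * (a ^ 4 + b ^ 4) := by
  have := Even.add_pow_le (a := a) (b := b) (n := 4) (by decide)
  norm_num at this
  exact this

theorem mainRes_pow_four_le (J : Fin n → Fin m) (i : Fin n) (x : CoordIdx n m D → ℝ) :
    θ.mainRes J i x ^ 4 ≤ 512 * (((1 - θ.s) * θ.a) ^ 4 * x (Sum.inl i, 0) ^ 4 +
      ((1 - θ.s) * θ.b) ^ 4 * x (Sum.inl i, 1) ^ 4 +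
      (θ.q * θ.s * θ.a) ^ 4 * x (Sum.inr (J i), 0) ^ 4 +
      (θ.q * θ.s * θ.b) ^ 4 * x (Sum.inr (J i), 1) ^ 4 + θ.mainConst ^ 4) := by
  have h : θ.mainRes J i x = ((1 - θ.s) * θ.a * x (Sum.inl i, 0) +
      (1 - θ.s) * θ.b * x (Sum.inl i, 1)) + (θ.q * θ.s * θ.a * x (Sum.inr (J i), 0) +
      (θ.q * θ.s * θ.b * x (Sum.inr (J i), 1) + θ.mainConst)) := by
    simp only [mainRes, resFt, resKnown, mainConst]; ring
  rw [h]
  simp_rw [← mul_pow]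
  generalize (1 - θ.s) * θ.a * x (Sum.inl i, 0) = A₁
  generalize (1 - θ.s) * θ.b * x (Sum.inl i, 1) = A₂
  generalize θ.q * θ.s * θ.a * x (Sum.inr (J i), 0) = A₃
  generalize θ.q * θ.s * θ.b * x (Sum.inr (J i), 1) = A₄
  generalize θ.mainConst = A₅
  have h1 := add_pow_four_le (A₁ + A₂) (A₃ + (A₄ + A₅))
  have h2 := add_pow_four_le A₁ A₂
  have h3 := add_pow_four_le A₃ (A₄ + A₅)
  have h4 := add_pow_four_le A₄ A₅
  have p1 : 0 ≤ A₁ ^ 4 := by positivity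
  have p2 : 0 ≤ A₂ ^ 4 := by positivity
  have p3 : 0 ≤ A₃ ^ 4 := by positivity
  linarith

section Moments

variable {μ : CoordIdx n m D → Measure ℝ} [∀ k, IsProbabilityMeasure (μ k)]
  [∀ k, AllMoments (μ k)] {v τ ρ K : ℝ}

@[fun_prop]
theorem hasMoments_mixTerm (J : Fin n → Fin m) (k : Fin (D + 2)) (i : Fin n) :
    HasMoments (θ.mixTerm J k i) (Measure.pi μ) := by
  unfold mixTerm; fun_prop

theorem integral_mixTerm_sq_le (h : CoordMoments μ v τ θ.ρ K) (J : Fin n → Fin m)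
    {k : Fin (D + 2)} (hk : k = 0 ∨ k = 1) (i : Fin n) :
    ∫ x, θ.mixTerm J k i x ^ 2 ∂Measure.pi μ ≤ θ.mixBound K := by
  have hfst : ∀ b, ∫ x : CoordIdx n m D → ℝ, x (b, 0) ^ 4 ∂Measure.pi μ ≤ K := fun b => by
    rw [integral_comp_eval_pi μ (b, 0) (φ := fun t => t ^ 4) (by fun_prop)]
    exact h.fst_fourth b
  have hsnd : ∀ b, ∫ x : CoordIdx n m D → ℝ, x (b, 1) ^ 4 ∂Measure.pi μ ≤ K := fun b => by
    rw [integral_comp_eval_pi μ (b, 1) (φ := fun t => t ^ 4) (by fun_prop)]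
    exact h.snd_fourth b
  have hk' : ∀ b, ∫ x : CoordIdx n m D → ℝ, x (b, k) ^ 4 ∂Measure.pi μ ≤ K := by
    rcases hk with rfl | rfl
    · exact hfst
    · exact hsnd
  calc ∫ x, θ.mixTerm J k i x ^ 2 ∂Measure.pi μ
      ≤ ∫ x, (4 * (1 - θ.s) ^ 4 * x (Sum.inl i, k) ^ 4 + 4 * θ.s ^ 4 * x (Sum.inr (J i), k) ^ 4 +
        (256 * ((1 - θ.s) * θ.a) ^ 4 * x (Sum.inl i, 0) ^ 4 +
        256 * ((1 - θ.s) * θ.b) ^ 4 * x (Sum.inl i, 1) ^ 4 +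
        (256 * (θ.q * θ.s * θ.a) ^ 4 * x (Sum.inr (J i), 0) ^ 4 +
        256 * (θ.q * θ.s * θ.b) ^ 4 * x (Sum.inr (J i), 1) ^ 4) +
        256 * θ.mainConst ^ 4)) ∂Measure.pi μ := by
        refine integral_mono (HasMoments.integrable (by fun_prop))
          (HasMoments.integrable (by fun_prop)) fun x => ?_
        simp only [mixTerm]
        have h1 := θ.mainRes_pow_four_le J i x
        have h2 := add_pow_four_le ((1 - θ.s) * x (Sum.inl i, k)) (θ.s * x (Sum.inr (J i), k))
        simp only [mul_pow _ _ 4] at h1 h2 ⊢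
        nlinarith [sq_nonneg (((1 - θ.s) * x (Sum.inl i, k) + θ.s * x (Sum.inr (J i), k)) ^ 2 -
          θ.mainRes J i x ^ 2)]
    _ ≤ 4 * (1 - θ.s) ^ 4 * K + 4 * θ.s ^ 4 * K +
        (256 * ((1 - θ.s) * θ.a) ^ 4 * K + 256 * ((1 - θ.s) * θ.b) ^ 4 * K +
        (256 * (θ.q * θ.s * θ.a) ^ 4 * K + 256 * (θ.q * θ.s * θ.b) ^ 4 * K) +
        256 * θ.mainConst ^ 4) := by
        repeat rw [integral_add (HasMoments.integrable (by fun_prop))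
          (HasMoments.integrable (by fun_prop))]
        simp only [integral_const_mul, integral_const, probReal_univ, one_smul]
        gcongr <;> first | exact hk' _ | exact hfst _ | exact hsnd _
    _ = θ.mixBound K := by rw [mixBound]; ring

theorem integral_mixTerm_zero (h : CoordMoments μ v τ θ.ρ K) (J : Fin n → Fin m) (i : Fin n) :
    ∫ x, θ.mixTerm J 0 i x ∂Measure.pi μ =
      θ.q * θ.offset + (1 - θ.s) ^ 2 * θ.a * v + θ.s ^ 2 * θ.q * θ.a * v := by
  have := integral_affine_mul_affine μ
    (e := ![(Sum.inl i, 0), (Sum.inl i, 1), (Sum.inr (J i), 0), (Sum.inr (J i), 1)])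
    (c := ![1, θ.ρ, 1, 0]) (v := ![v, 1 - θ.ρ ^ 2, v, 1])
    (fun k l hkl => by fin_cases k <;> fin_cases l <;> simp_all)
    (fun k => by
      fin_cases k
      exacts [h.fst_mean _, h.snd_mean_left _, h.fst_mean _, h.snd_mean_right _])
    (fun k => by
      fin_cases k
      exacts [h.fst_var _, h.snd_var_left _, h.fst_var _, h.snd_var_right _])
    1 (θ.q * θ.offset) ![1 - θ.s, 0, θ.s, 0]
    ![(1 - θ.s) * θ.a, (1 - θ.s) * θ.b, θ.q * θ.s * θ.a, θ.q * θ.s * θ.b]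
  simp only [Fin.sum_univ_four] at this
  simp at this
  convert this using 1
  · congr 1; ext x; simp only [mixTerm, mainRes, resFt, resKnown]; ring
  · ring

theorem integral_mixTerm_one (h : CoordMoments μ v τ θ.ρ K) (J : Fin n → Fin m) (i : Fin n) :
    ∫ x, θ.mixTerm J 1 i x ∂Measure.pi μ =
      (1 - θ.s) * θ.ρ * (θ.q * θ.offset) + (1 - θ.s) ^ 2 * θ.b * (1 - θ.ρ ^ 2) +
        θ.s ^ 2 * θ.q * θ.b := by
  have := integral_affine_mul_affine μ
    (e := ![(Sum.inl i, 0), (Sum.inl i, 1), (Sum.inr (J i), 0), (Sum.inr (J i), 1)])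
    (c := ![1, θ.ρ, 1, 0]) (v := ![v, 1 - θ.ρ ^ 2, v, 1])
    (fun k l hkl => by fin_cases k <;> fin_cases l <;> simp_all)
    (fun k => by
      fin_cases k
      exacts [h.fst_mean _, h.snd_mean_left _, h.fst_mean _, h.snd_mean_right _])
    (fun k => by
      fin_cases k
      exacts [h.fst_var _, h.snd_var_left _, h.fst_var _, h.snd_var_right _])
    ((1 - θ.s) * θ.ρ) (θ.q * θ.offset) ![0, 1 - θ.s, 0, θ.s]
    ![(1 - θ.s) * θ.a, (1 - θ.s) * θ.b, θ.q * θ.s * θ.a, θ.q * θ.s * θ.b]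
  simp only [Fin.sum_univ_four] at this
  simp at this
  convert this using 1
  · congr 1; ext x; simp only [mixTerm, mainRes, resFt, resKnown]; ring
  · ring

theorem integral_gradCore_sq_le (h : CoordMoments μ v τ θ.ρ K) (hn : 0 < n) (J : Fin n → Fin m)
    {k : Fin (D + 2)} (hk : k = 0 ∨ k = 1) {c : ℝ}
    (hc : ∀ i, ∫ x, θ.mixTerm J k i x ∂Measure.pi μ = -c) :
    ∫ x, θ.gradCore c J k x ^ 2 ∂Measure.pi μ ≤ θ.mixBound K * ∑ j, freq J j ^ 2 := by
  have hn' : (n : ℝ) ≠ 0 := by positivity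
  have hmean : ∀ i, ∫ x, (θ.mixTerm J k i x + c) ∂Measure.pi μ = 0 := fun i => by
    rw [integral_add (HasMoments.integrable (by fun_prop)) (integrable_const _), hc]
    simp
  have heq : ∀ x, θ.gradCore c J k x = (∑ i, (θ.mixTerm J k i x + c)) / n := fun x => by
    rw [Finset.sum_add_distrib, gradCore]
    simp only [mixTerm, Finset.sum_const, Finset.card_univ, Fintype.card_fin, nsmul_eq_mul]
    field_simp
  simp_rw [heq, div_pow]
  rw [integral_div]
  have hfib := integral_sq_sum_le_of_fiber (P := Measure.pi μ) J
    (f := fun i x => θ.mixTerm J k i x + c) (fun i => by fun_prop) (V := θ.mixBound K) ?_ ?_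
  · refine (div_le_div_of_nonneg_right hfib (by positivity)).trans (le_of_eq ?_)
    simp_rw [freq, div_pow]
    rw [← Finset.sum_div]
    ring
  · intro i i' hii
    have hne : i ≠ i' := fun hh => hii (by rw [hh])
    rw [integral_mul_of_dependsOn μ {p | p.1 = Sum.inl i ∨ p.1 = Sum.inr (J i)}
      (F := fun x => θ.mixTerm J k i x + c) (G := fun x => θ.mixTerm J k i' x + c), hmean, zero_mul]
    · intro x y hxy
      have hl : ∀ k, x (Sum.inl i, k) = y (Sum.inl i, k) := fun k => hxy _ (by simp)
      have hr : ∀ k, x (Sum.inr (J i), k) = y (Sum.inr (J i), k) := fun k => hxy _ (by simp)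
      simp only [mixTerm, mainRes, resFt, resKnown, hl, hr]
    · intro x y hxy
      have hl : ∀ k, x (Sum.inl i', k) = y (Sum.inl i', k) := fun k => hxy _ (by simp [hne.symm])
      have hr : ∀ k, x (Sum.inr (J i'), k) = y (Sum.inr (J i'), k) :=
        fun k => hxy _ (by simp [Ne.symm hii])
      simp only [mixTerm, mainRes, resFt, resKnown, hl, hr]
  · intro i
    have hsq : ∀ x, (θ.mixTerm J k i x + c) ^ 2 =
        θ.mixTerm J k i x ^ 2 + (2 * c * θ.mixTerm J k i x + c ^ 2) := fun x => by ring
    simp_rw [hsq]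
    rw [integral_add (HasMoments.integrable (by fun_prop)) (HasMoments.integrable (by fun_prop)),
      integral_add (HasMoments.integrable (by fun_prop)) (integrable_const _), integral_const_mul,
      hc]
    have := θ.integral_mixTerm_sq_le h J hk i
    simp
    nlinarith [sq_nonneg c]

/-- The bound on the squared distance between the trained weights and the comparison vector. -/
def distBound (lam : ℝ) (J : Fin n → Fin m) (x : CoordIdx n m D → ℝ) : ℝ :=
  2 / lam * ((∑ i, (θ.errFt i x + θ.errKnown (J i) x) ^ 2) / n) +
    4 / lam ^ 2 * (θ.gradCore (lam * θ.a) J 0 x ^ 2 + θ.gradCore (lam * θ.b) J 1 x ^ 2 +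
      ∑ l : Fin D, θ.gradNoise lam J l x ^ 2)

/-- The constant in the bound on the expectation of `distBound`. -/
def distConst (lam r v K : ℝ) : ℝ :=
  2 / lam * (2 * ((1 - θ.s) ^ 2 * (r ^ 2 * θ.κ ^ 2 * θ.sqKnown v)) +
    2 * (2 * (θ.s * θ.κ) ^ 2 * (r ^ 2 * (K + 1) * θ.sqKnown v))) +
  4 / lam ^ 2 * (2 * θ.mixBound K + r * (2 * (1 - θ.s) ^ 2 * (2 * θ.varFt v +
    2 * θ.q ^ 2 * θ.sqKnown v) + 2 * θ.s ^ 2 * (2 * θ.varFt v + 2 * (θ.q ^ 2 * θ.sqKnown v))))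

theorem integral_err_sq_le (h : CoordMoments μ v τ θ.ρ K) (hm : 0 < m)
    (hD : 0 < D) (hK : 0 ≤ K) {r : ℝ} (hτ : D * τ = r * m)
    (hκ : θ.s * θ.κ * r = 1 - θ.q) (J : Fin n → Fin m) (i : Fin n) :
    ∫ x, (θ.errFt i x + θ.errKnown (J i) x) ^ 2 ∂Measure.pi μ ≤
      (2 * ((1 - θ.s) ^ 2 * (r ^ 2 * θ.κ ^ 2 * θ.sqKnown v)) +
        2 * (2 * (θ.s * θ.κ) ^ 2 * (r ^ 2 * (K + 1) * θ.sqKnown v))) * (m / D) := by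
  have hm' : (0 : ℝ) < m := by positivity
  have hm1 : (1 : ℝ) ≤ m := by exact_mod_cast hm
  have hD' : (0 : ℝ) < D := by positivity
  have hτ' : τ = r * m / D := by field_simp; linarith
  have hC := θ.sqKnown_nonneg h ⟨0, hm⟩
  refine (integral_add_sq_le (by fun_prop) (by fun_prop)).trans ?_
  rw [θ.integral_errFt_sq h]
  have k1 := θ.integral_errKnown_sq_le h hm hτ hκ (J i)
  have k2 : (1 - θ.s) ^ 2 * (τ * (D * ((θ.κ / m) ^ 2 * (τ * (m * θ.sqKnown v))))) =
      ((1 - θ.s) ^ 2 * (r ^ 2 * θ.κ ^ 2 * θ.sqKnown v)) * (m / D) := by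
    rw [hτ']; field_simp
  have k3 : 2 * (θ.s * θ.κ / m) ^ 2 * (D * τ ^ 2 * (K + m) * θ.sqKnown v) ≤
      (2 * (θ.s * θ.κ) ^ 2 * (r ^ 2 * (K + 1) * θ.sqKnown v)) * (m / D) := by
    have : 2 * (θ.s * θ.κ / m) ^ 2 * (D * τ ^ 2 * (K + m) * θ.sqKnown v) =
        (2 * (θ.s * θ.κ) ^ 2 * (r ^ 2 * ((K + m) / m) * θ.sqKnown v)) * (m / D) := by
      rw [hτ']; field_simp
    rw [this]
    have : (K + m) / m ≤ K + 1 := by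
      rw [div_le_iff₀ hm']; nlinarith
    gcongr
  rw [k2]
  linarith

theorem integral_distBound_le (h : CoordMoments μ v τ θ.ρ K) (hn : 0 < n) (hm : 0 < m)
    (hD : 0 < D) (hK : 0 ≤ K) {r lam : ℝ} (hr : 0 < r) (hlam : 0 < lam) (hτ : D * τ = r * m)
    (hκ : θ.s * θ.κ * r = 1 - θ.q) (hκ' : lam * θ.κ = θ.s * θ.q)
    (h0 : θ.q * θ.offset + (1 - θ.s) ^ 2 * θ.a * v + θ.s ^ 2 * θ.q * θ.a * v = -(lam * θ.a))
    (h1 : (1 - θ.s) * θ.ρ * (θ.q * θ.offset) + (1 - θ.s) ^ 2 * θ.b * (1 - θ.ρ ^ 2) +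
        θ.s ^ 2 * θ.q * θ.b = -(lam * θ.b)) (J : Fin n → Fin m) :
    ∫ x, θ.distBound lam J x ∂Measure.pi μ ≤
      θ.distConst lam r v K * (m / D + m / n + m * freqDev J + 1 / m) := by
  have hn' : (0 : ℝ) < n := by positivity
  have hm' : (0 : ℝ) < m := by positivity
  have hm1 : (1 : ℝ) ≤ m := by exact_mod_cast hm
  have hD' : (0 : ℝ) < D := by positivity
  have hτ' : τ = r * m / D := by field_simp; linarith
  have hτ0 : 0 ≤ τ := by rw [hτ']; positivity
  have hC := θ.sqKnown_nonneg h ⟨0, hm⟩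
  have hU := θ.varFt_nonneg h ⟨0, hn⟩
  have hF := freqDev_nonneg J
  set E := (m : ℝ) / D + m / n + m * freqDev J + 1 / m with hE
  have e1 : (m : ℝ) / D ≤ E := by
    have : 0 ≤ (m : ℝ) / n + m * freqDev J + 1 / m := by positivity
    linarith
  have e2 : (m : ℝ) / n + m * freqDev J ≤ E := by
    have : 0 ≤ (m : ℝ) / D + 1 / m := by positivity
    linarith
  have e3 : freqDev J + 1 / m ≤ E := by
    have : 0 ≤ (m : ℝ) / D + m / n := by positivity
    nlinarith
  have hMix : 0 ≤ θ.mixBound K := by rw [mixBound]; positivity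
  have b1 : ∀ i, ∫ x, (θ.errFt i x + θ.errKnown (J i) x) ^ 2 ∂Measure.pi μ ≤
      (2 * ((1 - θ.s) ^ 2 * (r ^ 2 * θ.κ ^ 2 * θ.sqKnown v)) +
        2 * (2 * (θ.s * θ.κ) ^ 2 * (r ^ 2 * (K + 1) * θ.sqKnown v))) * E := fun i =>
    (θ.integral_err_sq_le h hm hD hK hτ hκ J i).trans (mul_le_mul_of_nonneg_left e1 (by positivity))
  have b2 : ∫ x, (∑ i, (θ.errFt i x + θ.errKnown (J i) x) ^ 2) / n ∂Measure.pi μ ≤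
      (2 * ((1 - θ.s) ^ 2 * (r ^ 2 * θ.κ ^ 2 * θ.sqKnown v)) +
        2 * (2 * (θ.s * θ.κ) ^ 2 * (r ^ 2 * (K + 1) * θ.sqKnown v))) * E := by
    rw [integral_div, integral_finsetSum _ fun i _ => HasMoments.integrable (by fun_prop),
      div_le_iff₀ hn']
    refine (Finset.sum_le_card_nsmul _ _ _ fun i _ => b1 i).trans (le_of_eq ?_)
    simp; ring
  have b3 := θ.integral_gradCore_sq_le h hn J (Or.inl rfl) (c := lam * θ.a)
    (fun i => (θ.integral_mixTerm_zero h J i).trans h0)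
  have b4 := θ.integral_gradCore_sq_le h hn J (Or.inr rfl) (c := lam * θ.b)
    (fun i => (θ.integral_mixTerm_one h J i).trans h1)
  rw [sum_freq_sq hn hm] at b3 b4
  have b5 := mul_le_mul_of_nonneg_left e3 hMix
  have b6 : ∫ x, ∑ l : Fin D, θ.gradNoise lam J l x ^ 2 ∂Measure.pi μ ≤
      r * (2 * (1 - θ.s) ^ 2 * (2 * θ.varFt v + 2 * θ.q ^ 2 * θ.sqKnown v) +
        2 * θ.s ^ 2 * (2 * θ.varFt v + 2 * (θ.q ^ 2 * θ.sqKnown v))) * E := by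
    rw [integral_finsetSum _ fun i _ => HasMoments.integrable (by fun_prop)]
    refine (Finset.sum_le_card_nsmul _ _ _
      fun l _ => θ.integral_gradNoise_sq_le h hτ0 hn hκ' J l).trans ?_
    simp only [Finset.card_univ, Fintype.card_fin, nsmul_eq_mul]
    rw [← mul_assoc, hτ]
    have p1 : (m : ℝ) / n ≤ E := (le_add_of_nonneg_right (by positivity)).trans e2
    have p2 : (m : ℝ) * freqDev J ≤ E := (le_add_of_nonneg_left (by positivity)).trans e2
    have q1 : 0 ≤ 2 * (1 - θ.s) ^ 2 * (2 * θ.varFt v + 2 * θ.q ^ 2 * θ.sqKnown v) +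
      2 * θ.s ^ 2 * (2 * θ.varFt v) := by positivity
    have q2 : 0 ≤ 2 * θ.s ^ 2 * (2 * (θ.q ^ 2 * θ.sqKnown v)) := by positivity
    have r1 := mul_le_mul_of_nonneg_left p1 q1
    have r2 := mul_le_mul_of_nonneg_left p2 q2
    calc _ = r * ((2 * (1 - θ.s) ^ 2 * (2 * θ.varFt v + 2 * θ.q ^ 2 * θ.sqKnown v) +
          2 * θ.s ^ 2 * (2 * θ.varFt v)) * (m / n) +
          2 * θ.s ^ 2 * (2 * (θ.q ^ 2 * θ.sqKnown v)) * (m * freqDev J)) := by ring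
      _ ≤ r * ((2 * (1 - θ.s) ^ 2 * (2 * θ.varFt v + 2 * θ.q ^ 2 * θ.sqKnown v) +
          2 * θ.s ^ 2 * (2 * θ.varFt v)) * E +
          2 * θ.s ^ 2 * (2 * (θ.q ^ 2 * θ.sqKnown v)) * E) := by gcongr
      _ = _ := by ring
  simp only [distBound]
  rw [integral_add (HasMoments.integrable (by fun_prop)) (HasMoments.integrable (by fun_prop)),
    integral_const_mul, integral_const_mul,
    integral_add (HasMoments.integrable (by fun_prop)) (HasMoments.integrable (by fun_prop)),
    integral_add (HasMoments.integrable (by fun_prop)) (HasMoments.integrable (by fun_prop))]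
  have l1 : 0 ≤ 2 / lam := by positivity
  have l2 : 0 ≤ 4 / lam ^ 2 := by positivity
  have f1 := mul_le_mul_of_nonneg_left b2 l1
  have f2 := mul_le_mul_of_nonneg_left (add_le_add (add_le_add b3 b4) b6) l2
  refine (add_le_add f1 (f2.trans (mul_le_mul_of_nonneg_left (add_le_add_left
    (add_le_add b5 b5) _) l2))).trans (le_of_eq ?_)
  rw [distConst]
  ring

end Moments

end Params

/-! ### Distance of the trained weights to a comparison vector -/

/-- Ridge regression: a vector `w` whose loss is at most that of `u` is close to `u` if the
residuals of `u` split into a small part `δ` and a part `R` for which the gradient is small. -/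
theorem sum_sub_sq_le_of_ridge_le {n d : ℕ} (X : Fin n → Fin d → ℝ) (y : Fin n → ℝ) {lam : ℝ}
    (hlam : 0 < lam) (w u : Fin d → ℝ) (R δ : Fin n → ℝ)
    (hres : ∀ i, X i ⬝ᵥ u - y i = R i + δ i)
    (hle : (∑ i, (X i ⬝ᵥ w - y i) ^ 2) / n + lam * ∑ l, w l ^ 2 ≤
      (∑ i, (X i ⬝ᵥ u - y i) ^ 2) / n + lam * ∑ l, u l ^ 2) :
    ∑ l, (w l - u l) ^ 2 ≤ 2 / lam * ((∑ i, δ i ^ 2) / n) +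
      4 / lam ^ 2 * ∑ l, ((∑ i, X i l * R i) / n + lam * u l) ^ 2 := by
  set h : Fin d → ℝ := w - u with hh
  have hw : ∀ i, X i ⬝ᵥ w - y i = R i + δ i + X i ⬝ᵥ h := fun i => by
    rw [← hres, hh, dotProduct_sub]; ring
  have hwl : ∀ l, w l = u l + h l := fun l => by simp [hh]
  have e1 : ∑ i, (X i ⬝ᵥ w - y i) ^ 2 = ∑ i, (X i ⬝ᵥ u - y i) ^ 2 +
      (2 * ∑ i, R i * (X i ⬝ᵥ h) + ∑ i, (2 * δ i * (X i ⬝ᵥ h) + (X i ⬝ᵥ h) ^ 2)) := by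
    rw [Finset.mul_sum, ← Finset.sum_add_distrib, ← Finset.sum_add_distrib]
    exact Finset.sum_congr rfl fun i _ => by rw [hw, hres]; ring
  have e2 : ∑ l, w l ^ 2 = ∑ l, u l ^ 2 + (2 * ∑ l, u l * h l + ∑ l, h l ^ 2) := by
    rw [Finset.mul_sum, ← Finset.sum_add_distrib, ← Finset.sum_add_distrib]
    exact Finset.sum_congr rfl fun l _ => by rw [hwl]; ring
  have e3 : (∑ i, R i * (X i ⬝ᵥ h)) / n + lam * ∑ l, u l * h l =
      ∑ l, ((∑ i, X i l * R i) / n + lam * u l) * h l := by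
    simp_rw [dotProduct, add_mul, Finset.sum_add_distrib, Finset.mul_sum]
    rw [Finset.sum_comm, Finset.sum_div]
    congr 1
    · refine Finset.sum_congr rfl fun l _ => ?_
      rw [div_mul_eq_mul_div, Finset.sum_mul]
      congr 1
      exact Finset.sum_congr rfl fun i _ => by ring
    · exact Finset.sum_congr rfl fun i _ => by ring
  have e4 : -(∑ i, δ i ^ 2) / n ≤ (∑ i, (2 * δ i * (X i ⬝ᵥ h) + (X i ⬝ᵥ h) ^ 2)) / n := by
    refine div_le_div_of_nonneg_right ?_ (Nat.cast_nonneg n)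
    rw [← Finset.sum_neg_distrib]
    exact Finset.sum_le_sum fun i _ => by nlinarith [sq_nonneg (δ i + X i ⬝ᵥ h)]
  have e5 : -(lam / 4 * ∑ l, h l ^ 2 +
      1 / lam * ∑ l, ((∑ i, X i l * R i) / n + lam * u l) ^ 2) ≤
      ∑ l, ((∑ i, X i l * R i) / n + lam * u l) * h l := by
    rw [Finset.mul_sum, Finset.mul_sum, ← Finset.sum_add_distrib, ← Finset.sum_neg_distrib]
    refine Finset.sum_le_sum fun l _ => ?_
    generalize (∑ i, X i l * R i) / n + lam * u l = g
    have : 0 ≤ 1 / lam * (g + lam / 2 * h l) ^ 2 := by positivity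
    have h2 : 1 / lam * (g + lam / 2 * h l) ^ 2 =
        1 / lam * g ^ 2 + g * h l + lam / 4 * h l ^ 2 := by field_simp; ring
    linarith
  rw [e1, e2, add_div, add_div, mul_div_assoc, mul_add] at hle
  have key : lam / 2 * ∑ l, h l ^ 2 ≤ (∑ i, δ i ^ 2) / n +
      2 / lam * ∑ l, ((∑ i, X i l * R i) / n + lam * u l) ^ 2 := by
    have : 2 / lam = 2 * (1 / lam) := by ring
    rw [neg_div] at e4
    rw [this]
    nlinarith
  have := mul_le_mul_of_nonneg_left key (show 0 ≤ 2 / lam by positivity)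
  calc ∑ l, (w l - u l) ^ 2 = 2 / lam * (lam / 2 * ∑ l, h l ^ 2) := by
        simp only [hh, Pi.sub_apply]; field_simp
    _ ≤ _ := this
    _ = _ := by ring

/-- All the inputs multiplied by their labels. -/
def signedInputs {n d m : ℕ} (S : DataSets n d m) (b : Fin n ⊕ Fin m) : Fin d → ℝ :=
  Sum.elim (fun i => sgn (S.1 i).label • (S.1 i).input)
    (fun j => sgn (S.2 j).label • (S.2 j).input) b

theorem sgn_mul_self (b : Bool) : sgn b * sgn b = 1 := by cases b <;> simp [sgn]

theorem sgn_sq (b : Bool) : sgn b ^ 2 = 1 := by rw [sq, sgn_mul_self]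

theorem trainLoss_eq {n d m : ℕ} (s lam : ℝ) (T : Trial n d m)
    (hT : ∀ i, (T.1.2 (T.2 i)).label = (T.1.1 i).label) (w : Fin d → ℝ) :
    trainLoss s lam T w = (∑ i, (((1 - s) • signedInputs T.1 (Sum.inl i) +
      s • signedInputs T.1 (Sum.inr (T.2 i))) ⬝ᵥ w - 1) ^ 2) / n + lam * ∑ l, w l ^ 2 := by
  rw [trainLoss]
  congr 2
  refine Finset.sum_congr rfl fun i _ => ?_
  simp only [signedInputs, Sum.elim_inl, Sum.elim_inr, hT i, mixedInput, add_dotProduct,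
    smul_dotProduct, smul_eq_mul]
  have h1 := sgn_sq (T.1.1 i).label
  generalize sgn (T.1.1 i).label = y at *
  linear_combination (-(((1 - s) * ((T.1.1 i).input ⬝ᵥ w) +
    s * ((T.1.2 (T.2 i)).input ⬝ᵥ w)) ^ 2 - 1)) * h1

/-- The trained weights are close to the comparison vector. -/
theorem sub_sq_add_sub_sq_le_distBound {n D m : ℕ} (θ : Params) {lam : ℝ} (hlam : 0 < lam)
    (T : Trial n (D + 2) m) (hT : ∀ i, (T.1.2 (T.2 i)).label = (T.1.1 i).label)
    (w : Fin (D + 2) → ℝ) (hw : IsMinOn (trainLoss θ.s lam T) Set.univ w) :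
    (w 0 - θ.a) ^ 2 + (w 1 - θ.b) ^ 2 ≤
      θ.distBound lam T.2 (fun p => signedInputs T.1 p.1 p.2) := by
  set x : CoordIdx n m D → ℝ := fun p => signedInputs T.1 p.1 p.2 with hx
  let u : Fin (D + 2) → ℝ := Fin.cons θ.a (Fin.cons θ.b fun l => θ.noiseWeight l x)
  have hu := hw (Set.mem_univ u)
  simp only [Set.mem_ofPred_eq, trainLoss_eq _ _ _ hT] at hu
  have hdot : ∀ b, signedInputs T.1 b ⬝ᵥ u = x (b, 0) * θ.a + (x (b, 1) * θ.b +
      ∑ l : Fin D, x (b, l.succ.succ) * θ.noiseWeight l x) := fun b => by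
    simp only [dotProduct, Fin.sum_univ_succ, u, Fin.cons_zero, Fin.cons_succ, hx]
    rfl
  have key := sum_sub_sq_le_of_ridge_le _ (fun _ => 1) hlam w u (θ.mainRes T.2 · x)
    (fun i => θ.errFt i x + θ.errKnown (T.2 i) x) (fun i => by
      simp only [add_dotProduct, smul_dotProduct, smul_eq_mul, hdot, Params.mainRes, Params.errFt,
        Params.errKnown, Params.resFt, Params.resKnown, Params.offset]
      ring) hu
  have h1 : (w 0 - θ.a) ^ 2 + (w 1 - θ.b) ^ 2 ≤ ∑ l, (w l - u l) ^ 2 := by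
    rw [Fin.sum_univ_succ, Fin.sum_univ_succ, ← add_assoc]
    exact le_add_of_nonneg_right (Finset.sum_nonneg fun _ _ => sq_nonneg _)
  refine h1.trans (key.trans (le_of_eq ?_))
  rw [Params.distBound, Fin.sum_univ_succ, Fin.sum_univ_succ]
  rw [← add_assoc]
  rfl

/-! ### The law of the labels and of the inputs multiplied by their labels -/

/-- The uniform law on the labels. -/
def labelLaw : Measure Bool := (2⁻¹ : ℝ≥0∞) • (Measure.dirac true + Measure.dirac false)

instance : IsProbabilityMeasure labelLaw :=
  ⟨by simp [labelLaw, ENNReal.inv_two_add_inv_two]⟩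

/-- The law of a sign that is `1` with probability `p`. -/
def signLaw (p : ℝ) : Measure ℝ :=
  ENNReal.ofReal p • Measure.dirac 1 + ENNReal.ofReal (1 - p) • Measure.dirac (-1)

theorem isProbabilityMeasure_signLaw {p : ℝ} (hp : p ∈ Set.Icc (0 : ℝ) 1) :
    IsProbabilityMeasure (signLaw p) :=
  ⟨by simp [signLaw, ← ENNReal.ofReal_add hp.1 (sub_nonneg.2 hp.2)]⟩

/-- Product laws on `ℝ^d` whose second factor is `ν`. -/
def coordLaw {d : ℕ} (σ₁ τ : ℝ≥0) (ν : Measure ℝ) (l : Fin d) : Measure ℝ :=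
  if (l : ℕ) = 0 then gaussianReal 1 (σ₁ ^ 2) else if (l : ℕ) = 1 then ν else gaussianReal 0 τ

instance {d : ℕ} (σ₁ τ : ℝ≥0) (ν : Measure ℝ) [IsProbabilityMeasure ν] (l : Fin d) :
    IsProbabilityMeasure (coordLaw σ₁ τ ν l) := by
  unfold coordLaw; split_ifs <;> infer_instance

/-- The label of an example and its input multiplied by the label. -/
def signedExample {d : ℕ} (e : Example d) : Bool × (Fin d → ℝ) := (e.label, sgn e.label • e.input)

theorem measurable_sgn : Measurable sgn := measurable_of_countable _

theorem measurable_signedExample {d : ℕ} : Measurable (signedExample : Example d → _) := by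
  have := measurable_sgn
  unfold signedExample Example.label Example.input
  fun_prop

theorem inputLaw_map_smul (d : ℕ) (σ₁ σξ : ℝ≥0) (y a : Bool) :
    (inputLaw d σ₁ 0 σξ y a).map (fun x => sgn y • x) =
      Measure.pi (coordLaw σ₁ (σξ ^ 2 / ((d - 2 : ℕ) : ℝ≥0)) (Measure.dirac (sgn y * sgn a))) := by
  have h : (fun x : Fin d → ℝ => sgn y • x) = fun x i => sgn y * x i := rfl
  rw [inputLaw, h, Measure.pi_map_pi (fun i => by fun_prop)]
  congr 1
  ext1 l
  rw [gaussianReal_map_const_mul]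
  have hy : NNReal.mk (sgn y ^ 2) (sq_nonneg _) = 1 := by ext; simp [sgn_sq]
  rw [hy, one_mul, coordLaw, coordMean, coordVar]
  split_ifs
  · rw [sgn_mul_self]
  · simp
  · simp

theorem pi_coordLaw_signLaw {d : ℕ} (hd : 2 ≤ d) (σ₁ τ : ℝ≥0) {p : ℝ}
    (hp : p ∈ Set.Icc (0 : ℝ) 1) :
    Measure.pi (coordLaw (d := d) σ₁ τ (signLaw p)) =
      ENNReal.ofReal p • Measure.pi (coordLaw σ₁ τ (Measure.dirac 1)) +
        ENNReal.ofReal (1 - p) • Measure.pi (coordLaw σ₁ τ (Measure.dirac (-1))) := by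
  have := isProbabilityMeasure_signLaw hp
  refine Measure.pi_eq fun s hs => ?_
  have key : ∀ (ν : Measure ℝ), ∏ l, coordLaw σ₁ τ ν l (s l) =
      ν (s ⟨1, by omega⟩) * ∏ l ∈ Finset.univ.erase (⟨1, by omega⟩ : Fin d),
        coordLaw σ₁ τ (Measure.dirac 0) l (s l) := fun ν => by
    rw [← Finset.mul_prod_erase _ _ (Finset.mem_univ (⟨1, by omega⟩ : Fin d))]
    congr 1
    refine Finset.prod_congr rfl fun l hl => ?_
    have : (l : ℕ) ≠ 1 := fun h => (Finset.mem_erase.1 hl).1 (Fin.ext h)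
    simp [coordLaw, this]
  simp only [Measure.add_apply, Measure.smul_apply, Measure.pi_pi, key, smul_eq_mul, signLaw]
  ring

theorem measurePreserving_signedExample {d : ℕ} (hd : 2 ≤ d) (σ₁ σξ : ℝ≥0) {p : ℝ}
    (hp : p ∈ Set.Icc (0 : ℝ) 1) :
    MeasurePreserving signedExample (dataLaw d σ₁ 0 σξ p)
      (labelLaw.prod (Measure.pi
        (coordLaw σ₁ (σξ ^ 2 / ((d - 2 : ℕ) : ℝ≥0)) (signLaw p)))) := by
  refine ⟨measurable_signedExample, ?_⟩
  have hmap : ∀ y a, ((inputLaw d σ₁ 0 σξ y a).prod (Measure.dirac (y, a))).map signedExample =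
      (Measure.dirac y).prod (Measure.pi (coordLaw σ₁ (σξ ^ 2 / ((d - 2 : ℕ) : ℝ≥0))
        (Measure.dirac (sgn y * sgn a)))) := fun y a => by
    have : IsProbabilityMeasure (inputLaw d σ₁ 0 σξ y a) := by unfold inputLaw; infer_instance
    rw [Measure.prod_dirac, Measure.map_map measurable_signedExample (by fun_prop),
      ← inputLaw_map_smul, Measure.dirac_prod, Measure.map_map (by fun_prop) (by fun_prop)]
    rfl
  have h2 : ENNReal.ofReal (1 / 2) = 2⁻¹ := by
    rw [one_div, ENNReal.ofReal_inv_of_pos two_pos]; simp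
  have hw : ∀ q : ℝ, ENNReal.ofReal (1 / 2 * q) = 2⁻¹ * ENNReal.ofReal q := fun q => by
    rw [ENNReal.ofReal_mul (by norm_num), h2]
  simp only [dataLaw, Fintype.sum_bool, Measure.map_add _ _ measurable_signedExample,
    Measure.map_smul, hmap, hw, pi_coordLaw_signLaw hd _ _ hp, labelLaw, Measure.prod_smul_left,
    Measure.add_prod, Measure.prod_add, Measure.prod_smul_right, sgn]
  simp [smul_add, smul_smul, mul_comm (ENNReal.ofReal _) 2⁻¹]
  abel

/-- The laws of the coordinates of all the inputs multiplied by their labels. -/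
def sampleLaw (n m D : ℕ) (σ₁ τ : ℝ≥0) (p : ℝ) (k : CoordIdx n m D) : Measure ℝ :=
  coordLaw σ₁ τ (signLaw (Sum.elim (fun _ => p) (fun _ => 1 / 2) k.1)) k.2

theorem isProbabilityMeasure_sampleLaw {n m D : ℕ} (σ₁ τ : ℝ≥0) {p : ℝ}
    (hp : p ∈ Set.Icc (0 : ℝ) 1) (k : CoordIdx n m D) :
    IsProbabilityMeasure (sampleLaw n m D σ₁ τ p k) := by
  have : IsProbabilityMeasure (signLaw (Sum.elim (fun _ => p) (fun _ => 1 / 2) k.1)) := by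
    rcases k with ⟨_ | _, l⟩
    · exact isProbabilityMeasure_signLaw hp
    · exact isProbabilityMeasure_signLaw ⟨by norm_num, by norm_num⟩
  unfold sampleLaw
  infer_instance

theorem measurePreserving_curry_symm {ι κ : Type*} [Fintype ι] [Fintype κ]
    (μ : ι → κ → Measure ℝ) [∀ i j, IsProbabilityMeasure (μ i j)] :
    MeasurePreserving (fun (z : ι → κ → ℝ) (p : ι × κ) => z p.1 p.2)
      (Measure.pi fun i => Measure.pi (μ i)) (Measure.pi fun p => μ p.1 p.2) := by
  refine ⟨by fun_prop, ?_⟩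
  have := Measure.infinitePi_map_curry_symm μ
  simp_rw [Measure.infinitePi_eq_pi] at this
  exact this

instance isProbabilityMeasure_inputLaw (d : ℕ) (σ₁ σ₂ σξ : ℝ≥0) (y a : Bool) :
    IsProbabilityMeasure (inputLaw d σ₁ σ₂ σξ y a) := by unfold inputLaw; infer_instance

theorem isProbabilityMeasure_dataLaw {d : ℕ} (hd : 2 ≤ d) (σ₁ σξ : ℝ≥0) {p : ℝ}
    (hp : p ∈ Set.Icc (0 : ℝ) 1) : IsProbabilityMeasure (dataLaw d σ₁ 0 σξ p) := by
  have := isProbabilityMeasure_signLaw hp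
  have h := measurePreserving_signedExample hd σ₁ σξ hp
  exact ⟨by rw [← Set.preimage_univ (f := signedExample),
    h.measure_preimage MeasurableSet.univ.nullMeasurableSet, measure_univ]⟩

/-- The labels are independent of the inputs multiplied by the labels. -/
theorem measurePreserving_labels_signedInputs (n m D : ℕ) (σ₁ σξ : ℝ≥0) {p : ℝ}
    (hp : p ∈ Set.Icc (0 : ℝ) 1) :
    MeasurePreserving (fun S : DataSets n (D + 2) m =>
        (labels S, fun k : CoordIdx n m D => signedInputs S k.1 k.2))
      ((Measure.pi fun _ : Fin n => dataLaw (D + 2) σ₁ 0 σξ p).prod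
        (Measure.pi fun _ : Fin m => dataLaw (D + 2) σ₁ 0 σξ (1 / 2)))
      (((Measure.pi fun _ : Fin n => labelLaw).prod (Measure.pi fun _ : Fin m => labelLaw)).prod
        (Measure.pi (sampleLaw n m D σ₁ (σξ ^ 2 / (D : ℝ≥0)) p))) := by
  let pr : Fin n ⊕ Fin m → ℝ := Sum.elim (fun _ => p) (fun _ => 1 / 2)
  have hpr : ∀ b, pr b ∈ Set.Icc (0 : ℝ) 1 := by
    rintro (_ | _)
    · exact hp
    · exact ⟨by norm_num [pr], by norm_num [pr]⟩
  have i1 := fun b => isProbabilityMeasure_signLaw (hpr b)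
  have i2 := fun b => isProbabilityMeasure_dataLaw (d := D + 2) (by omega) σ₁ σξ (hpr b)
  have i3 : ∀ b, SigmaFinite (dataLaw (D + 2) σ₁ 0 σξ (pr b)) := fun b =>
    have := i2 b; IsFiniteMeasure.toSigmaFinite _
  have e1 := (measurePreserving_sumPiEquivProdPi_symm
    (fun b : Fin n ⊕ Fin m => dataLaw (D + 2) σ₁ 0 σξ (pr b)))
  have e2 := measurePreserving_pi _ _ fun b : Fin n ⊕ Fin m =>
    measurePreserving_signedExample (d := D + 2) (by omega) σ₁ σξ (hpr b)
  have e3 := measurePreserving_arrowProdEquivProdArrow Bool (Fin (D + 2) → ℝ) (Fin n ⊕ Fin m)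
    (fun _ => labelLaw) (fun b => Measure.pi (coordLaw σ₁ (σξ ^ 2 / (D : ℝ≥0)) (signLaw (pr b))))
  have e4 := (measurePreserving_sumPiEquivProdPi (fun _ : Fin n ⊕ Fin m => labelLaw)).prod
    (measurePreserving_curry_symm fun b : Fin n ⊕ Fin m =>
      coordLaw (d := D + 2) σ₁ (σξ ^ 2 / (D : ℝ≥0)) (signLaw (pr b)))
  have e := e4.comp (e3.comp (e2.comp e1))
  convert e using 1
  · ext S : 1
    refine Prod.ext rfl ?_
    ext ⟨b, l⟩
    rcases b with i | j <;> rfl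
  · rfl
  · rfl

/-! ### Moments of the coordinates -/

instance (μ : ℝ) (v : ℝ≥0) : AllMoments (gaussianReal μ v) :=
  ⟨fun p hp => memLp_id_gaussianReal' p hp⟩

theorem integral_signLaw {p : ℝ} (hp : p ∈ Set.Icc (0 : ℝ) 1) (f : ℝ → ℝ) :
    ∫ t, f t ∂signLaw p = p * f 1 + (1 - p) * f (-1) := by
  have hint : ∀ c a : ℝ, Integrable f (ENNReal.ofReal c • Measure.dirac a) := fun c a =>
    (integrable_dirac (by simp)).smul_measure ENNReal.ofReal_ne_top
  rw [signLaw, integral_add_measure (hint _ _) (hint _ _), integral_smul_measure,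
    integral_smul_measure, integral_dirac, integral_dirac, ENNReal.toReal_ofReal hp.1,
    ENNReal.toReal_ofReal (sub_nonneg.2 hp.2), smul_eq_mul, smul_eq_mul]

theorem allMoments_signLaw {p : ℝ} (hp : p ∈ Set.Icc (0 : ℝ) 1) : AllMoments (signLaw p) := by
  have := isProbabilityMeasure_signLaw hp
  refine ⟨fun q _ => MemLp.of_bound measurable_id.aestronglyMeasurable 1 ?_⟩
  rw [signLaw, ae_add_measure_iff]
  constructor <;> refine Measure.ae_smul_measure ?_ _ <;> simp [ae_dirac_eq]

theorem integral_sub_mean_gaussianReal (μ : ℝ) (v : ℝ≥0) :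
    ∫ t, (t - μ) ∂gaussianReal μ v = 0 := by
  rw [integral_sub AllMoments.hasMoments_id.integrable (integrable_const _),
    integral_id_gaussianReal]
  simp

theorem integral_sub_mean_sq_gaussianReal (μ : ℝ) (v : ℝ≥0) :
    ∫ t, (t - μ) ^ 2 ∂gaussianReal μ v = v := by
  have h := variance_fun_id_gaussianReal (μ := μ) (v := v)
  rwa [variance_eq_integral (by fun_prop), integral_id_gaussianReal] at h

theorem integral_sq_sub_sq_gaussianReal (v : ℝ≥0) :
    ∫ t, (t ^ 2 - (v : ℝ)) ^ 2 ∂gaussianReal 0 v =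
      (∫ t, (t ^ 2 - 1) ^ 2 ∂gaussianReal 0 1) * (v : ℝ) ^ 2 := by
  have h : gaussianReal 0 v = (gaussianReal 0 1).map (Real.sqrt v * ·) := by
    rw [gaussianReal_map_const_mul, mul_zero, mul_one]
    congr 1
    ext
    simp
  rw [h, integral_map (by fun_prop) (by fun_prop), ← integral_mul_const]
  congr 1
  ext t
  rw [mul_pow, Real.sq_sqrt (NNReal.coe_nonneg v)]
  ring

/-- A bound for the fourth moments of the coordinates. -/
def fourthBound (σ₁ : ℝ≥0) : ℝ :=
  (∫ t, t ^ 4 ∂gaussianReal 1 (σ₁ ^ 2)) + 1 + ∫ t, (t ^ 2 - 1) ^ 2 ∂gaussianReal 0 1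

theorem fourthBound_nonneg (σ₁ : ℝ≥0) : 0 ≤ fourthBound σ₁ := by
  have h1 : 0 ≤ ∫ t, t ^ 4 ∂gaussianReal 1 (σ₁ ^ 2) := integral_nonneg fun t => by positivity
  have h2 : 0 ≤ ∫ t : ℝ, (t ^ 2 - 1) ^ 2 ∂gaussianReal 0 1 := integral_nonneg fun t => by positivity
  rw [fourthBound]; linarith

variable {n m D : ℕ}

theorem allMoments_sampleLaw (σ₁ τ : ℝ≥0) {p : ℝ} (hp : p ∈ Set.Icc (0 : ℝ) 1)
    (k : CoordIdx n m D) : AllMoments (sampleLaw n m D σ₁ τ p k) := by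
  have : AllMoments (signLaw (Sum.elim (fun _ => p) (fun _ => 1 / 2) k.1)) := by
    rcases k with ⟨_ | _, l⟩
    · exact allMoments_signLaw hp
    · exact allMoments_signLaw ⟨by norm_num, by norm_num⟩
  unfold sampleLaw coordLaw
  split_ifs <;> infer_instance

theorem coordMoments_sampleLaw (σ₁ τ : ℝ≥0) {p : ℝ} (hp : p ∈ Set.Icc (0 : ℝ) 1) :
    CoordMoments (sampleLaw n m D σ₁ τ p) ((σ₁ : ℝ) ^ 2) τ (2 * p - 1) (fourthBound σ₁) := by
  have hhalf : (1 / 2 : ℝ) ∈ Set.Icc (0 : ℝ) 1 := ⟨by norm_num, by norm_num⟩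
  have h1 : 0 ≤ ∫ t, t ^ 4 ∂gaussianReal 1 (σ₁ ^ 2) := integral_nonneg fun t => by positivity
  have h2 : 0 ≤ ∫ t : ℝ, (t ^ 2 - 1) ^ 2 ∂gaussianReal 0 1 := integral_nonneg fun t => by positivity
  have fst : ∀ b, sampleLaw n m D σ₁ τ p (b, 0) = gaussianReal 1 (σ₁ ^ 2) := fun b => by
    simp [sampleLaw, coordLaw]
  have sndl : ∀ i, sampleLaw n m D σ₁ τ p (Sum.inl i, 1) = signLaw p := fun i => by
    simp [sampleLaw, coordLaw]
  have sndr : ∀ j, sampleLaw n m D σ₁ τ p (Sum.inr j, 1) = signLaw (1 / 2) := fun j => by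
    simp [sampleLaw, coordLaw]
  have noise : ∀ b (l : Fin D), sampleLaw n m D σ₁ τ p (b, l.succ.succ) = gaussianReal 0 τ :=
    fun b l => by simp [sampleLaw, coordLaw]
  refine ⟨fun b => ?_, fun b => ?_, fun b => ?_, fun i => ?_, fun i => ?_, fun j => ?_, fun j => ?_,
    fun b => ?_, fun b l => ?_, fun b l => ?_, fun b l => ?_⟩
  · rw [fst, integral_sub_mean_gaussianReal]
  · rw [fst, integral_sub_mean_sq_gaussianReal]; simp
  · rw [fst, fourthBound]; linarith
  · rw [sndl, integral_signLaw hp (fun t => t - (2 * p - 1))]; ring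
  · rw [sndl, integral_signLaw hp (fun t => (t - (2 * p - 1)) ^ 2)]; ring
  · rw [sndr, integral_signLaw hhalf (fun t => t - 0)]; norm_num
  · rw [sndr, integral_signLaw hhalf (fun t => (t - 0) ^ 2)]; norm_num
  · rcases b with i | j
    · rw [sndl, integral_signLaw hp (fun t => t ^ 4), fourthBound]; linarith
    · rw [sndr, integral_signLaw hhalf (fun t => t ^ 4), fourthBound]; linarith
  · rw [noise, integral_id_gaussianReal]
  · rw [noise]; simpa using integral_sub_mean_sq_gaussianReal 0 τ
  · rw [noise, integral_sq_sub_sq_gaussianReal]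
    refine mul_le_mul_of_nonneg_right ?_ (sq_nonneg _)
    rw [fourthBound]; linarith

/-! ### The selection indices -/

theorem HasMoments.of_finite {Ω : Type*} [MeasurableSpace Ω] [DiscreteMeasurableSpace Ω] [Finite Ω]
    {P : Measure Ω} [IsFiniteMeasure P] (f : Ω → ℝ) : HasMoments f P :=
  fun _ _ => MemLp.of_discrete

theorem integral_freq_sub_sq_le (hn : 0 < n) (ν : Measure (Fin m)) [IsProbabilityMeasure ν]
    (j : Fin m) (c : ℝ) :
    ∫ J, (freq J j - c) ^ 2 ∂(Measure.pi fun _ : Fin n => ν) ≤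
      ν.real {j} / n + (ν.real {j} - c) ^ 2 := by
  have hn' : (n : ℝ) ≠ 0 := by positivity
  set π := ν.real {j} with hπ
  let f : Fin n → (Fin n → Fin m) → ℝ := fun i J => Set.indicator {j} 1 (J i) - π
  have hind : ∀ i, ∫ J : Fin n → Fin m, Set.indicator {j} (1 : Fin m → ℝ) (J i)
      ∂(Measure.pi fun _ : Fin n => ν) = π := fun i => by
    have h := integral_map (μ := Measure.pi fun _ : Fin n => ν)
      (measurable_pi_apply i).aemeasurable
      (f := Set.indicator {j} (1 : Fin m → ℝ)) (StronglyMeasurable.of_discrete.aestronglyMeasurable)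
    rw [(measurePreserving_eval (fun _ : Fin n => ν) i).map_eq,
      integral_indicator_one (measurableSet_singleton j)] at h
    exact h.symm
  have hmean : ∀ i, ∫ J, f i J ∂(Measure.pi fun _ : Fin n => ν) = 0 := fun i => by
    rw [integral_sub (HasMoments.of_finite _).integrable (integrable_const _), hind]
    simp
  have hsq : ∀ i, ∫ J, f i J ^ 2 ∂(Measure.pi fun _ : Fin n => ν) ≤ π := fun i => by
    have : ∀ J, f i J ^ 2 = (1 - 2 * π) * Set.indicator {j} 1 (J i) + π ^ 2 := fun J => by
      by_cases hJ : J i = j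
      · simp [f, hJ]; ring
      · simp [f, hJ]
    simp_rw [this]
    rw [integral_add (HasMoments.of_finite _).integrable (integrable_const _), integral_const_mul,
      hind]
    simp
    nlinarith [sq_nonneg π]
  have horth : ∀ i ∈ Finset.univ, ∀ i' ∈ Finset.univ, i ≠ i' →
      ∫ J, f i J * f i' J ∂(Measure.pi fun _ : Fin n => ν) = 0 := fun i _ i' _ hii => by
    rw [integral_mul_of_dependsOn (fun _ : Fin n => ν) {i}, hmean, zero_mul]
    · intro x y h; simp only [f]; rw [h i rfl]
    · intro x y h; simp only [f]; rw [h i' hii.symm]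
  have hsum : ∀ J, (freq J j - c) = (∑ i, f i J) / n + (π - c) := fun J => by
    simp only [f, freq, Finset.sum_sub_distrib, Finset.sum_const, Finset.card_univ,
      Fintype.card_fin, nsmul_eq_mul, Set.indicator_apply, Set.mem_singleton_iff, Pi.one_apply,
      Finset.sum_boole]
    field_simp
    ring
  have hexp : ∀ J, (freq J j - c) ^ 2 = (∑ i, f i J) ^ 2 / n ^ 2 +
      (2 * (π - c) / n * (∑ i, f i J) + (π - c) ^ 2) := fun J => by rw [hsum]; ring
  simp_rw [hexp]
  rw [integral_add (HasMoments.of_finite _).integrable (HasMoments.of_finite _).integrable,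
    integral_add (HasMoments.of_finite _).integrable (integrable_const _), integral_const_mul,
    integral_finsetSum _ fun i _ => (HasMoments.of_finite _).integrable, integral_div,
    integral_sq_sum_of_orthogonal _ (fun i => HasMoments.of_finite _) horth]
  simp only [hmean, Finset.sum_const_zero, mul_zero, zero_add, integral_const, probReal_univ,
    one_smul]
  have : (∑ i, ∫ J, f i J ^ 2 ∂(Measure.pi fun _ : Fin n => ν)) / n ^ 2 ≤ π / n := by
    rw [div_le_div_iff₀ (by positivity) (by positivity)]
    have h := Finset.sum_le_card_nsmul Finset.univ _ π fun i _ => hsq i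
    simp only [Finset.card_univ, Fintype.card_fin, nsmul_eq_mul] at h
    nlinarith [mul_le_mul_of_nonneg_right h (Nat.cast_nonneg (α := ℝ) n)]
  linarith

theorem integral_freqDev_le (hn : 0 < n) (ν : Measure (Fin m)) [IsProbabilityMeasure ν] :
    ∫ J, freqDev J ∂(Measure.pi fun _ : Fin n => ν) ≤
      1 / n + ∑ j, (ν.real {j} - 1 / m) ^ 2 := by
  simp only [freqDev]
  rw [integral_finsetSum _ fun i _ => (HasMoments.of_finite _).integrable]
  refine (Finset.sum_le_sum fun j _ => integral_freq_sub_sq_le hn ν j (1 / m)).trans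
    (le_of_eq ?_)
  rw [Finset.sum_add_distrib, ← Finset.sum_div]
  congr 2
  simp

/-- The sum of the labels. -/
def labelSum (y : Fin m → Bool) : ℝ := ∑ j, sgn (y j)

theorem two_mul_card_label (y : Fin m → Bool) (b : Bool) :
    2 * ((Finset.univ.filter fun j => y j = b).card : ℝ) = m + sgn b * labelSum y := by
  have : ∀ j, (1 : ℝ) + sgn b * sgn (y j) = 2 * if y j = b then 1 else 0 := fun j => by
    cases y j <;> cases b <;> norm_num [sgn]
  have h := Finset.sum_congr (rfl : (Finset.univ : Finset (Fin m)) = _) fun j _ => this j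
  rw [Finset.sum_add_distrib, ← Finset.mul_sum, ← Finset.mul_sum] at h
  simp at h
  rw [labelSum]
  linarith

theorem integral_labelSum_sq (m : ℕ) :
    ∫ y, labelSum y ^ 2 ∂(Measure.pi fun _ : Fin m => labelLaw) = m := by
  simp only [labelSum]
  have hmean : ∫ b, sgn b ∂labelLaw = 0 := by
    rw [labelLaw, integral_smul_measure, integral_add_measure .of_finite .of_finite]
    simp [sgn]
  have hmean' : ∀ i : Fin m, ∫ y : Fin m → Bool, sgn (y i)
      ∂(Measure.pi fun _ : Fin m => labelLaw) = 0 := fun i => by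
    have h := integral_map (μ := Measure.pi fun _ : Fin m => labelLaw)
      (measurable_pi_apply i).aemeasurable (f := sgn)
      (StronglyMeasurable.of_discrete.aestronglyMeasurable)
    rw [(measurePreserving_eval (fun _ : Fin m => labelLaw) i).map_eq, hmean] at h
    exact h.symm
  rw [integral_sq_sum_of_orthogonal _ (fun i => HasMoments.of_finite _)]
  · simp [sgn_sq]
  · intro i _ i' _ hii
    rw [integral_mul_of_dependsOn (fun _ : Fin m => labelLaw) {i} (F := fun y => sgn (y i))
      (G := fun y => sgn (y i')), hmean', zero_mul]
    · intro x y h; simp only; rw [h i rfl]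
    · intro x y h; simp only; rw [h i' hii.symm]

/-- The law of a selection index given the labels of the known examples. -/
def indexLaw (y' : Fin m → Bool) : Measure (Fin m) :=
  (2⁻¹ : ℝ≥0∞) • (uniformOn {j | y' j = true} + uniformOn {j | y' j = false})

theorem exists_label_eq {y' : Fin m → Bool} (hm : 0 < m) (hy : 2 * |labelSum y'| < m) (b : Bool) :
    ∃ j, y' j = b := by
  by_contra! h
  have h1 := two_mul_card_label y' b
  rw [Finset.filter_false_of_mem (by simpa using h)] at h1
  have : |sgn b * labelSum y'| = |labelSum y'| := by cases b <;> simp [sgn]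
  have h2 := neg_abs_le (sgn b * labelSum y')
  have hm' : (0 : ℝ) < m := by positivity
  simp at h1
  linarith

theorem isProbabilityMeasure_uniformOn_label {y' : Fin m → Bool} {b : Bool}
    (h : ∃ j, y' j = b) : IsProbabilityMeasure (uniformOn {j | y' j = b}) :=
  isProbabilityMeasure_uniformOn (Set.toFinite _) h

theorem isProbabilityMeasure_indexLaw {y' : Fin m → Bool} (hy : ∀ b, ∃ j, y' j = b) :
    IsProbabilityMeasure (indexLaw y') := by
  have h1 := isProbabilityMeasure_uniformOn_label (hy true)
  have h2 := isProbabilityMeasure_uniformOn_label (hy false)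
  exact ⟨by simp [indexLaw, ENNReal.inv_two_add_inv_two]⟩

theorem uniformOn_label_real_singleton (y' : Fin m → Bool) (b : Bool) (j : Fin m) :
    (uniformOn {j | y' j = b}).real {j} =
      if y' j = b then 1 / ((Finset.univ.filter fun j => y' j = b).card : ℝ) else 0 := by
  have : {j | y' j = b} = ((Finset.univ.filter fun j => y' j = b : Finset (Fin m)) : Set (Fin m)) := by
    ext; simp
  rw [Measure.real, this, ← Finset.coe_singleton, uniformOn_apply_finset]
  split_ifs with h
  · rw [Finset.inter_singleton_of_mem (by simp [h])]
    simp
  · rw [Finset.inter_singleton_of_notMem (by simp [h])]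
    simp

theorem indexLaw_real_singleton {y' : Fin m → Bool} (hm : 0 < m) (hy : 2 * |labelSum y'| < m)
    (j : Fin m) : (indexLaw y').real {j} = 1 / (m + sgn (y' j) * labelSum y') := by
  have h1 := isProbabilityMeasure_uniformOn_label (exists_label_eq hm hy true)
  have h2 := isProbabilityMeasure_uniformOn_label (exists_label_eq hm hy false)
  rw [indexLaw, measureReal_ennreal_smul_apply, measureReal_add_apply,
    uniformOn_label_real_singleton, uniformOn_label_real_singleton, ← two_mul_card_label]
  cases y' j <;> simp [mul_comm]

theorem sum_indexLaw_sub_sq_le {y' : Fin m → Bool} (hm : 0 < m) (hy : 2 * |labelSum y'| < m) :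
    ∑ j, ((indexLaw y').real {j} - 1 / m) ^ 2 ≤ 4 * labelSum y' ^ 2 / m ^ 3 := by
  have hm' : (0 : ℝ) < m := by positivity
  have hj : ∀ j, ((indexLaw y').real {j} - 1 / m) ^ 2 ≤ 4 * labelSum y' ^ 2 / m ^ 4 := fun j => by
    rw [indexLaw_real_singleton hm hy]
    have h1 : |sgn (y' j) * labelSum y'| = |labelSum y'| := by cases y' j <;> simp [sgn]
    have h2 : (sgn (y' j) * labelSum y') ^ 2 = labelSum y' ^ 2 := by rw [mul_pow, sgn_sq, one_mul]
    have h3 := neg_abs_le (sgn (y' j) * labelSum y')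
    rw [← h2]
    generalize sgn (y' j) * labelSum y' = t at *
    have h4 : (m : ℝ) / 2 ≤ m + t := by linarith
    have h5 : (0 : ℝ) < m + t := by linarith
    have h6 : (1 / (m + t) - 1 / m) ^ 2 = t ^ 2 / (m ^ 2 * (m + t) ^ 2) := by
      field_simp; ring
    have h7 : 4 * t ^ 2 / m ^ 4 = t ^ 2 / ((m : ℝ) ^ 2 * (m / 2) ^ 2) := by field_simp; ring
    rw [h6, h7]
    gcongr
  refine (Finset.sum_le_card_nsmul _ _ _ fun j _ => hj j).trans (le_of_eq ?_)
  simp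
  field_simp

theorem selectLaw_eq {y : Fin n → Bool} {y' : Fin m → Bool} (hy : ∀ b, ∃ j, y' j = b) :
    selectLaw y y' = Measure.pi fun i => uniformOn {j | y' j = y i} := by
  unfold selectLaw
  congr 1
  ext1 i
  rw [if_pos (hy _)]

theorem isProbabilityMeasure_selectLaw (hm : 0 < m) (y : Fin n → Bool) (y' : Fin m → Bool) :
    IsProbabilityMeasure (selectLaw y y') := by
  classical
  have : Nonempty (Fin m) := ⟨⟨0, hm⟩⟩
  unfold selectLaw
  have : ∀ i, IsProbabilityMeasure
      (if ∃ j, y' j = y i then uniformOn {j | y' j = y i} else uniformOn Set.univ) := fun i => by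
    split_ifs with h
    · exact isProbabilityMeasure_uniformOn_label h
    · exact isProbabilityMeasure_uniformOn Set.finite_univ Set.univ_nonempty
  convert! (inferInstance : IsProbabilityMeasure (Measure.pi fun i =>
    if ∃ j, y' j = y i then uniformOn {j | y' j = y i} else uniformOn Set.univ))

theorem selectLaw_singleton_eq_zero {y : Fin n → Bool} {y' : Fin m → Bool}
    (hy : ∀ b, ∃ j, y' j = b) {J : Fin n → Fin m} (hJ : ¬ ∀ i, y' (J i) = y i) :
    selectLaw y y' {J} = 0 := by
  have := fun i => isProbabilityMeasure_uniformOn_label (hy (y i))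
  push Not at hJ
  obtain ⟨i, hi⟩ := hJ
  rw [selectLaw_eq hy, Measure.pi_singleton]
  refine Finset.prod_eq_zero (Finset.mem_univ i) ?_
  rw [uniformOn_eq_zero_iff (Set.toFinite _)]
  ext j
  simp only [Set.mem_inter_iff, Set.mem_ofPred_eq, Set.mem_singleton_iff, Set.mem_empty_iff_false,
    iff_false, not_and]
  rintro h rfl
  exact hi h

theorem lintegral_selectLaw_singleton {y' : Fin m → Bool} (hy : ∀ b, ∃ j, y' j = b)
    (J : Fin n → Fin m) :
    ∫⁻ y, selectLaw y y' {J} ∂(Measure.pi fun _ : Fin n => labelLaw) =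
      (Measure.pi fun _ : Fin n => indexLaw y') {J} := by
  have hp := isProbabilityMeasure_indexLaw hy
  have h1 := fun b => isProbabilityMeasure_uniformOn_label (hy b)
  have hl : ∀ b, labelLaw {b} = 2⁻¹ := fun b => by cases b <;> simp [labelLaw]
  rw [lintegral_fintype, Measure.pi_singleton]
  simp_rw [selectLaw_eq hy, Measure.pi_singleton, ← Finset.prod_mul_distrib, hl]
  have := Finset.prod_univ_sum (fun _ : Fin n => (Finset.univ : Finset Bool))
    (fun i b => uniformOn {j | y' j = b} {J i} * (2⁻¹ : ℝ≥0∞))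
  rw [Fintype.piFinset_univ] at this
  rw [← this]
  refine Finset.prod_congr rfl fun i _ => ?_
  simp [indexLaw, mul_comm]

/-! ### Probabilities under the law of a training run -/

theorem isMarkovKernel_selectKernel (hm : 0 < m) : IsMarkovKernel (selectKernel n m) :=
  ⟨fun ys => isProbabilityMeasure_selectLaw hm ys.1 ys.2⟩

/-- The probability of an event that depends on the labels, on the selection indices and on the
inputs multiplied by the labels. -/
theorem trialLaw_setOf_signedInputs_mem (hm : 0 < m) (σ₁ σξ : ℝ≥0) {p : ℝ}
    (hp : p ∈ Set.Icc (0 : ℝ) 1)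
    {bad : (Fin n → Bool) × (Fin m → Bool) → (Fin n → Fin m) → Set (CoordIdx n m D → ℝ)}
    (hbad : ∀ ys J, MeasurableSet (bad ys J)) :
    trialLaw n (D + 2) m σ₁ 0 σξ p
        {T | (fun k : CoordIdx n m D => signedInputs T.1 k.1 k.2) ∈ bad (labels T.1) T.2} =
      ∫⁻ ys, ∑ J, selectLaw ys.1 ys.2 {J} *
        Measure.pi (sampleLaw n m D σ₁ (σξ ^ 2 / (D : ℝ≥0)) p) (bad ys J)
        ∂((Measure.pi fun _ : Fin n => labelLaw).prod (Measure.pi fun _ : Fin m => labelLaw)) := by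
  have hhalf : (1 / 2 : ℝ) ∈ Set.Icc (0 : ℝ) 1 := ⟨by norm_num, by norm_num⟩
  have i1 := isMarkovKernel_selectKernel (n := n) hm
  have i2 := isProbabilityMeasure_dataLaw (d := D + 2) (by omega) σ₁ σξ hp
  have i3 := isProbabilityMeasure_dataLaw (d := D + 2) (by omega) σ₁ σξ hhalf
  have i4 := fun k : CoordIdx n m D =>
    isProbabilityMeasure_sampleLaw (n := n) (m := m) σ₁ (σξ ^ 2 / (D : ℝ≥0)) hp k
  have hmp := measurePreserving_labels_signedInputs n m D σ₁ σξ hp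
  let F : ((Fin n → Bool) × (Fin m → Bool)) × (CoordIdx n m D → ℝ) → ℝ≥0∞ := fun z =>
    ∑ J, selectLaw z.1.1 z.1.2 {J} * (bad z.1 J).indicator 1 z.2
  have hB : ∀ J, MeasurableSet {z : ((Fin n → Bool) × (Fin m → Bool)) × (CoordIdx n m D → ℝ) |
      z.2 ∈ bad z.1 J} := fun J => by
    have : {z : ((Fin n → Bool) × (Fin m → Bool)) × (CoordIdx n m D → ℝ) | z.2 ∈ bad z.1 J} =
        ⋃ ys, {ys} ×ˢ bad ys J := by
      ext ⟨ys, x⟩; simp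
    rw [this]
    exact MeasurableSet.iUnion fun ys => (measurableSet_singleton ys).prod (hbad ys J)
  have hF : Measurable F := by
    refine Finset.measurable_sum _ fun J _ => Measurable.mul ?_ ?_
    · exact (measurable_of_countable fun ys : (Fin n → Bool) × (Fin m → Bool) =>
        selectLaw ys.1 ys.2 {J}).comp measurable_fst
    · exact measurable_one.indicator (hB J)
  have hset : MeasurableSet {T : Trial n (D + 2) m |
      (fun k : CoordIdx n m D => signedInputs T.1 k.1 k.2) ∈ bad (labels T.1) T.2} := by
    have : {T : Trial n (D + 2) m |
        (fun k : CoordIdx n m D => signedInputs T.1 k.1 k.2) ∈ bad (labels T.1) T.2} =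
        ⋃ J, (Prod.fst ⁻¹' ((fun S : DataSets n (D + 2) m =>
          (labels S, fun k : CoordIdx n m D => signedInputs S k.1 k.2)) ⁻¹'
            {z | z.2 ∈ bad z.1 J})) ∩ Prod.snd ⁻¹' {J} := by
      ext T; simp
    rw [this]
    exact MeasurableSet.iUnion fun J => (measurable_fst (hmp.measurable (hB J))).inter
      (measurable_snd (measurableSet_singleton J))
  rw [trialLaw, Measure.compProd_apply hset]
  have hinner : ∀ S : DataSets n (D + 2) m, (Kernel.comap (selectKernel n m) labels
      measurable_labels) S (Prod.mk S ⁻¹' {T : Trial n (D + 2) m |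
        (fun k : CoordIdx n m D => signedInputs T.1 k.1 k.2) ∈ bad (labels T.1) T.2}) =
      F (labels S, fun k : CoordIdx n m D => signedInputs S k.1 k.2) := fun S => by
    have hk : (Kernel.comap (selectKernel n m) labels measurable_labels) S =
      selectLaw (labels S).1 (labels S).2 := rfl
    rw [hk, ← lintegral_indicator_one (MeasurableSet.of_discrete), lintegral_fintype]
    refine Finset.sum_congr rfl fun J _ => ?_
    rw [mul_comm]
    rfl
  simp_rw [hinner]
  rw [hmp.lintegral_comp hF, lintegral_prod _ hF.aemeasurable]
  refine lintegral_congr fun ys => ?_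
  simp only [F]
  rw [lintegral_finsetSum _ fun J _ => (measurable_one.indicator (hbad ys J)).const_mul _]
  refine Finset.sum_congr rfl fun J _ => ?_
  rw [lintegral_const_mul _ (measurable_one.indicator (hbad ys J)),
    lintegral_indicator_one (hbad ys J)]

/-- The bad event of a selection: labels do not match, or the inputs lie in an exceptional set. -/
theorem trialLaw_bad_le (hn : 0 < n) (hm : 0 < m) (σ₁ σξ : ℝ≥0) {p : ℝ}
    (hp : p ∈ Set.Icc (0 : ℝ) 1) {bad : (Fin n → Fin m) → Set (CoordIdx n m D → ℝ)}
    (hbad : ∀ J, MeasurableSet (bad J)) {A B : ℝ} (hA : 0 ≤ A) (hB : 0 ≤ B)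
    (hle : ∀ J, Measure.pi (sampleLaw n m D σ₁ (σξ ^ 2 / (D : ℝ≥0)) p) (bad J) ≤
      ENNReal.ofReal (A + B * freqDev J)) :
    trialLaw n (D + 2) m σ₁ 0 σξ p {T | (¬ ∀ i, (T.1.2 (T.2 i)).label = (T.1.1 i).label) ∨
        (fun k : CoordIdx n m D => signedInputs T.1 k.1 k.2) ∈ bad T.2} ≤
      ENNReal.ofReal (4 / m + A + B * (1 / n + 4 / m ^ 2)) := by
  classical
  have hm' : (0 : ℝ) < m := by positivity
  have i4 := fun k : CoordIdx n m D =>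
    isProbabilityMeasure_sampleLaw (n := n) (m := m) σ₁ (σξ ^ 2 / (D : ℝ≥0)) hp k
  set Q := Measure.pi (sampleLaw n m D σ₁ (σξ ^ 2 / (D : ℝ≥0)) p) with hQ
  let bad' : (Fin n → Bool) × (Fin m → Bool) → (Fin n → Fin m) → Set (CoordIdx n m D → ℝ) :=
    fun ys J => if ∀ i, ys.2 (J i) = ys.1 i then bad J else Set.univ
  have hbad' : ∀ ys J, MeasurableSet (bad' ys J) := fun ys J => by
    simp only [bad']; split_ifs
    exacts [hbad J, MeasurableSet.univ]
  have hset : {T : Trial n (D + 2) m | (¬ ∀ i, (T.1.2 (T.2 i)).label = (T.1.1 i).label) ∨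
      (fun k : CoordIdx n m D => signedInputs T.1 k.1 k.2) ∈ bad T.2} =
      {T | (fun k : CoordIdx n m D => signedInputs T.1 k.1 k.2) ∈ bad' (labels T.1) T.2} := by
    ext T
    simp only [Set.mem_ofPred_eq, bad', labels]
    split_ifs with h <;> simp [h]
  rw [hset, trialLaw_setOf_signedInputs_mem hm σ₁ σξ hp hbad', ← hQ,
    lintegral_prod_symm _ (measurable_of_countable _).aemeasurable]
  have hone : ∀ y y', ∑ J : Fin n → Fin m, selectLaw y y' {J} * Q (bad' (y, y') J) ≤ 1 := by
    intro y y'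
    have := isProbabilityMeasure_selectLaw hm y y'
    calc ∑ J : Fin n → Fin m, selectLaw y y' {J} * Q (bad' (y, y') J)
        ≤ ∑ J : Fin n → Fin m, selectLaw y y' {J} :=
          Finset.sum_le_sum fun J _ => mul_le_of_le_one_right' prob_le_one
      _ = 1 := by simp
  have hbound : ∀ y' : Fin m → Bool, ∫⁻ y, ∑ J, selectLaw y y' {J} * Q (bad' (y, y') J)
      ∂(Measure.pi fun _ : Fin n => labelLaw) ≤ ENNReal.ofReal (4 * labelSum y' ^ 2 / m ^ 2 +
        (A + B * (1 / n + 4 * labelSum y' ^ 2 / m ^ 3))) := by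
    intro y'
    by_cases hy : 2 * |labelSum y'| < m
    · have hy' := exists_label_eq hm hy
      have i5 := isProbabilityMeasure_indexLaw hy'
      have hQJ : ∀ y J, selectLaw y y' {J} * Q (bad' (y, y') J) ≤
          selectLaw y y' {J} * ENNReal.ofReal (A + B * freqDev J) := by
        intro y J
        by_cases h : ∀ i, y' (J i) = y i
        · simp only [bad']
          rw [if_pos h]
          gcongr
          exact hle J
        · rw [selectLaw_singleton_eq_zero hy' h, zero_mul, zero_mul]
      calc ∫⁻ y, ∑ J, selectLaw y y' {J} * Q (bad' (y, y') J)
            ∂(Measure.pi fun _ : Fin n => labelLaw)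
          ≤ ∫⁻ y, ∑ J, selectLaw y y' {J} * ENNReal.ofReal (A + B * freqDev J)
            ∂(Measure.pi fun _ : Fin n => labelLaw) :=
            lintegral_mono fun y => Finset.sum_le_sum fun J _ => hQJ y J
        _ = ∑ J, (Measure.pi fun _ : Fin n => indexLaw y') {J} *
            ENNReal.ofReal (A + B * freqDev J) := by
            rw [lintegral_finsetSum _ fun J _ => measurable_of_countable _]
            refine Finset.sum_congr rfl fun J _ => ?_
            rw [lintegral_mul_const _ (measurable_of_countable _),
              lintegral_selectLaw_singleton hy']
        _ = ∫⁻ J, ENNReal.ofReal (A + B * freqDev J)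
            ∂(Measure.pi fun _ : Fin n => indexLaw y') := by
            rw [lintegral_fintype]
            exact Finset.sum_congr rfl fun J _ => mul_comm _ _
        _ = ENNReal.ofReal (∫ J, (A + B * freqDev J)
            ∂(Measure.pi fun _ : Fin n => indexLaw y')) := by
            rw [ofReal_integral_eq_lintegral_ofReal (HasMoments.of_finite _).integrable]
            exact ae_of_all _ fun J => add_nonneg hA (mul_nonneg hB (freqDev_nonneg J))
        _ ≤ _ := by
            refine ENNReal.ofReal_le_ofReal ?_
            rw [integral_add (integrable_const _) (HasMoments.of_finite _).integrable,
              integral_const_mul]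
            have h1 := (integral_freqDev_le hn (indexLaw y')).trans
              (add_le_add_right (sum_indexLaw_sub_sq_le hm hy) _)
            have h2 := mul_le_mul_of_nonneg_left h1 hB
            have h3 : 0 ≤ 4 * labelSum y' ^ 2 / (m : ℝ) ^ 2 := by positivity
            simp only [integral_const, probReal_univ, one_smul]
            linarith
    · have h1 : (1 : ℝ) ≤ 4 * labelSum y' ^ 2 / m ^ 2 := by
        rw [le_div_iff₀ (by positivity), one_mul]
        have h2 : (m : ℝ) ^ 2 ≤ (2 * |labelSum y'|) ^ 2 :=
          pow_le_pow_left₀ hm'.le (not_lt.1 hy) 2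
        rw [mul_pow, sq_abs] at h2
        linarith
      have h3 : 0 ≤ A + B * (1 / n + 4 * labelSum y' ^ 2 / (m : ℝ) ^ 3) := by positivity
      calc _ ≤ ∫⁻ _ : Fin n → Bool, 1 ∂(Measure.pi fun _ : Fin n => labelLaw) :=
            lintegral_mono fun y => hone y y'
        _ = ENNReal.ofReal 1 := by simp
        _ ≤ _ := ENNReal.ofReal_le_ofReal (by linarith)
  refine (lintegral_mono hbound).trans (le_of_eq ?_)
  rw [← ofReal_integral_eq_lintegral_ofReal (HasMoments.of_finite _).integrable
    (ae_of_all _ fun y' => by positivity)]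
  congr 1
  have : ∀ y' : Fin m → Bool, 4 * labelSum y' ^ 2 / (m : ℝ) ^ 2 +
      (A + B * (1 / n + 4 * labelSum y' ^ 2 / m ^ 3)) =
      (4 / m ^ 2 + B * 4 / m ^ 3) * labelSum y' ^ 2 + (A + B / n) := fun y' => by ring
  simp_rw [this]
  rw [integral_add (HasMoments.of_finite _).integrable (integrable_const _), integral_const_mul,
    integral_labelSum_sq]
  simp
  field_simp
  ring

/-! ### The test loss -/

theorem cond_dataLaw_attr_ne_label (d : ℕ) (σ₁ σ₂ σξ : ℝ≥0) {μ : ℝ} (hμ1 : μ < 1) :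
    cond (dataLaw d σ₁ σ₂ σξ μ) {e : Example d | e.attr ≠ e.label} = (2⁻¹ : ℝ≥0∞) •
      ((inputLaw d σ₁ σ₂ σξ true false).prod (Measure.dirac (true, false)) +
        (inputLaw d σ₁ σ₂ σξ false true).prod (Measure.dirac (false, true))) := by
  have hs : {e : Example d | e.attr ≠ e.label} =
      Set.univ ×ˢ {c : Bool × Bool | c.2 ≠ c.1} := by
    ext e; simp
  have hr : ∀ y a, ((inputLaw d σ₁ σ₂ σξ y a).prod (Measure.dirac (y, a))).restrict
      {e : Example d | e.attr ≠ e.label} =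
      if a ≠ y then (inputLaw d σ₁ σ₂ σξ y a).prod (Measure.dirac (y, a)) else 0 := fun y a => by
    classical
    rw [hs, ← Measure.prod_restrict, Measure.restrict_univ, restrict_dirac]
    by_cases h : a = y <;> simp [h]
  have h2 : ENNReal.ofReal (1 / 2) = 2⁻¹ := by
    rw [one_div, ENNReal.ofReal_inv_of_pos two_pos]; simp
  have hw : ENNReal.ofReal (1 / 2 * (1 - μ)) = ENNReal.ofReal (1 - μ) * 2⁻¹ := by
    rw [ENNReal.ofReal_mul (by norm_num), h2, mul_comm]
  have hpos : ENNReal.ofReal (1 - μ) ≠ 0 := by simpa using hμ1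
  have hrestr : (dataLaw d σ₁ σ₂ σξ μ).restrict {e : Example d | e.attr ≠ e.label} =
      ENNReal.ofReal (1 - μ) • (2⁻¹ : ℝ≥0∞) •
      ((inputLaw d σ₁ σ₂ σξ true false).prod (Measure.dirac (true, false)) +
        (inputLaw d σ₁ σ₂ σξ false true).prod (Measure.dirac (false, true))) := by
    simp only [dataLaw, Fintype.sum_bool, Measure.restrict_add, Measure.restrict_smul, hr]
    simp only [ne_eq, not_true_eq_false, if_false, smul_zero, zero_add, add_zero, reduceCtorEq,
      not_false_eq_true, if_true, hw, smul_add, smul_smul]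
  have hmass : dataLaw d σ₁ σ₂ σξ μ {e : Example d | e.attr ≠ e.label} =
      ENNReal.ofReal (1 - μ) := by
    rw [← Measure.restrict_apply_univ, hrestr]
    simp [ENNReal.inv_two_add_inv_two, ← mul_add]
  rw [ProbabilityTheory.cond, hmass, hrestr, smul_smul,
    ENNReal.inv_mul_cancel hpos ENNReal.ofReal_ne_top, one_smul]

theorem integral_inputLaw_sq (D : ℕ) (σ₁ σξ : ℝ≥0) (y a : Bool) (w : Fin (D + 2) → ℝ) :
    ∫ x, (x ⬝ᵥ w - sgn y) ^ 2 ∂inputLaw (D + 2) σ₁ 0 σξ y a =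
      (sgn y * w 0 + sgn a * w 1 - sgn y) ^ 2 + (σ₁ : ℝ) ^ 2 * w 0 ^ 2 +
        (σξ : ℝ) ^ 2 / D * ∑ l : Fin D, w l.succ.succ ^ 2 := by
  have h := integral_affine_mul_affine
    (fun i : Fin (D + 2) => gaussianReal (coordMean y a i) (coordVar σ₁ 0 σξ i))
    (e := id) Function.injective_id (c := coordMean y a)
    (v := fun i => (coordVar σ₁ 0 σξ i : ℝ)) (fun i => integral_sub_mean_gaussianReal _ _)
    (fun i => integral_sub_mean_sq_gaussianReal _ _)
    (∑ i, w i * coordMean y a i - sgn y) (∑ i, w i * coordMean y a i - sgn y) w w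
  rw [inputLaw]
  convert h using 1
  · congr 1
    ext x
    rw [← sq]
    congr 1
    rw [← add_sub_right_comm, ← Finset.sum_add_distrib]
    congr 1
    exact Finset.sum_congr rfl fun i _ => by simp only [id]; ring
  · simp only [Fin.sum_univ_succ, coordMean, coordVar]
    simp [Finset.mul_sum]
    ring_nf

theorem testLoss_eq (D : ℕ) (σ₁ σξ : ℝ≥0) {μ : ℝ} (hμ1 : μ < 1) (w : Fin (D + 2) → ℝ) :
    testLoss (D + 2) σ₁ 0 σξ μ w = (w 0 - w 1 - 1) ^ 2 + (σ₁ : ℝ) ^ 2 * w 0 ^ 2 +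
        (σξ : ℝ) ^ 2 / D * ∑ l : Fin D, w l.succ.succ ^ 2 := by
  have hm : ∀ y a, HasMoments (fun x : Fin (D + 2) → ℝ => (x ⬝ᵥ w - sgn y) ^ 2)
      (inputLaw (D + 2) σ₁ 0 σξ y a) := fun y a => by
    unfold inputLaw dotProduct; fun_prop
  have hf : Measurable fun e : Example (D + 2) => (e.input ⬝ᵥ w - sgn e.label) ^ 2 := by
    have := measurable_sgn
    unfold Example.input Example.label dotProduct
    fun_prop
  have hint : ∀ y a, Integrable (fun e : Example (D + 2) => (e.input ⬝ᵥ w - sgn e.label) ^ 2)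
      ((inputLaw (D + 2) σ₁ 0 σξ y a).prod (Measure.dirac (y, a))) := fun y a => by
    rw [Measure.prod_dirac, integrable_map_measure hf.aestronglyMeasurable (by fun_prop)]
    exact (hm y a).integrable
  have hval : ∀ y a, ∫ e : Example (D + 2), (e.input ⬝ᵥ w - sgn e.label) ^ 2
      ∂((inputLaw (D + 2) σ₁ 0 σξ y a).prod (Measure.dirac (y, a))) =
      (sgn y * w 0 + sgn a * w 1 - sgn y) ^ 2 + (σ₁ : ℝ) ^ 2 * w 0 ^ 2 +
        (σξ : ℝ) ^ 2 / D * ∑ l : Fin D, w l.succ.succ ^ 2 := fun y a => by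
    rw [← integral_inputLaw_sq, Measure.prod_dirac,
      integral_map (by fun_prop) hf.aestronglyMeasurable]
  rw [testLoss, cond_dataLaw_attr_ne_label _ _ _ _ hμ1, integral_smul_measure,
    integral_add_measure (hint _ _) (hint _ _), hval, hval]
  simp [sgn]
  ring

/-- The trained weights are bounded. -/
theorem sum_sq_le_of_isMinOn {n d m : ℕ} {s lam : ℝ} (hlam : 0 < lam) (T : Trial n d m)
    (w : Fin d → ℝ) (hw : IsMinOn (trainLoss s lam T) Set.univ w) :
    ∑ l, w l ^ 2 ≤ 1 / lam := by
  have h := hw (Set.mem_univ 0)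
  simp only [Set.mem_ofPred_eq, trainLoss, dotProduct_zero, zero_sub, neg_sq, sgn_sq] at h
  have h0 : 0 ≤ (∑ i, (mixedInput s T i ⬝ᵥ w - sgn (T.1.1 i).label) ^ 2) / n := by positivity
  have h1 : ((n : ℝ) / n) ≤ 1 := div_self_le_one _
  simp at h
  rw [le_div_iff₀ hlam]
  linarith

/-! ### The comparison vector of the theorem -/

/-- The determinant of the limiting normal equations. -/
def limitDet (s p r lam σ₁ : ℝ) : ℝ := ψ₁ s r lam σ₁ * ψ₃ s p r lam - ψ₂ s p r lam ^ 2

/-- The constants of the comparison vector. -/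
def limitParams (s p r lam σ₁ : ℝ) : Params where
  s := s
  ρ := 2 * p - 1
  a := q s r lam / limitDet s p r lam σ₁ *
    (ψ₃ s p r lam - ψ₂ s p r lam * (1 - s) * (2 * p - 1))
  b := q s r lam / limitDet s p r lam σ₁ *
    (ψ₁ s r lam σ₁ * (1 - s) * (2 * p - 1) - ψ₂ s p r lam)
  q := q s r lam
  κ := s / (s ^ 2 * r + lam)

theorem limitLoss_eq (s p r lam σ₁ : ℝ) :
    limitLoss s p r lam σ₁ =
      ((limitParams s p r lam σ₁).a - (limitParams s p r lam σ₁).b - 1) ^ 2 +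
        σ₁ ^ 2 * (limitParams s p r lam σ₁).a ^ 2 := by
  simp only [limitLoss, limitParams, limitDet]
  ring

section Limit

variable {s p r lam σ₁ : ℝ}

theorem limitDet_pos (hp : 1 / 2 < p) (hp1 : p ≤ 1) (hr : 0 < r) (hlam : 0 < lam) :
    0 < limitDet s p r lam σ₁ := by
  have hq : 0 ≤ q s r lam := by rw [q]; positivity
  have e1 : ψ₁ s r lam σ₁ = (1 - s) ^ 2 * σ₁ ^ 2 + q s r lam * (1 + s ^ 2 * σ₁ ^ 2) + lam := by
    rw [ψ₁]; ring
  have e2 : ψ₂ s p r lam = q s r lam * ((1 - s) * (2 * p - 1)) := by rw [ψ₂]; ring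
  have e3 : ψ₃ s p r lam = (1 - s) ^ 2 * (1 - (2 * p - 1) ^ 2) +
      q s r lam * (((1 - s) * (2 * p - 1)) ^ 2 + s ^ 2) + lam := by rw [ψ₃]; ring
  have hρ : 0 ≤ 1 - (2 * p - 1) ^ 2 := by nlinarith
  have h1 : q s r lam + lam ≤ ψ₁ s r lam σ₁ := by
    rw [e1]
    have : 0 ≤ (1 - s) ^ 2 * σ₁ ^ 2 + q s r lam * (s ^ 2 * σ₁ ^ 2) := by positivity
    linarith
  have h3 : q s r lam * ((1 - s) * (2 * p - 1)) ^ 2 + lam ≤ ψ₃ s p r lam := by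
    rw [e3]
    have : 0 ≤ (1 - s) ^ 2 * (1 - (2 * p - 1) ^ 2) + q s r lam * s ^ 2 := by positivity
    linarith
  have h4 := mul_le_mul h1 h3 (by positivity) (le_trans (by positivity) h1)
  rw [limitDet, e2]
  have h5 : 0 ≤ q s r lam * lam + lam * (q s r lam * ((1 - s) * (2 * p - 1)) ^ 2) := by positivity
  have h6 : 0 < lam * lam := by positivity
  nlinarith

theorem limitParams_sq_noise (hr : 0 < r) (hlam : 0 < lam) :
    (limitParams s p r lam σ₁).s * (limitParams s p r lam σ₁).κ * r =
      1 - (limitParams s p r lam σ₁).q := by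
  have : s ^ 2 * r + lam ≠ 0 := by positivity
  simp only [limitParams, q]
  field_simp
  ring

theorem limitParams_ridge (lam : ℝ) :
    lam * (limitParams s p r lam σ₁).κ =
      (limitParams s p r lam σ₁).s * (limitParams s p r lam σ₁).q := by
  simp only [limitParams, q]
  ring

theorem limitParams_normal_fst (hdet : limitDet s p r lam σ₁ ≠ 0) :
    ψ₁ s r lam σ₁ * (limitParams s p r lam σ₁).a + ψ₂ s p r lam * (limitParams s p r lam σ₁).b =
      q s r lam := by
  simp only [limitParams]
  field_simp
  rw [limitDet]
  ring

theorem limitParams_normal_snd (hdet : limitDet s p r lam σ₁ ≠ 0) :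
    ψ₂ s p r lam * (limitParams s p r lam σ₁).a + ψ₃ s p r lam * (limitParams s p r lam σ₁).b =
      q s r lam * ((1 - s) * (2 * p - 1)) := by
  simp only [limitParams]
  field_simp
  rw [limitDet]
  ring

theorem limitParams_stationary_fst (hdet : limitDet s p r lam σ₁ ≠ 0) :
    let θ := limitParams s p r lam σ₁
    θ.q * θ.offset + (1 - θ.s) ^ 2 * θ.a * σ₁ ^ 2 + θ.s ^ 2 * θ.q * θ.a * σ₁ ^ 2 =
      -(lam * θ.a) := by
  intro θ
  have h := limitParams_normal_fst hdet
  have e1 : θ.q = q s r lam := rfl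
  have e2 : θ.s = s := rfl
  have e3 : θ.ρ = 2 * p - 1 := rfl
  rw [Params.offset, e1, e2, e3]
  rw [ψ₁, ψ₂] at h
  linear_combination h

theorem limitParams_stationary_snd (hdet : limitDet s p r lam σ₁ ≠ 0) :
    let θ := limitParams s p r lam σ₁
    (1 - θ.s) * θ.ρ * (θ.q * θ.offset) + (1 - θ.s) ^ 2 * θ.b * (1 - θ.ρ ^ 2) +
      θ.s ^ 2 * θ.q * θ.b = -(lam * θ.b) := by
  intro θ
  have h := limitParams_normal_snd hdet
  have e1 : θ.q = q s r lam := rfl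
  have e2 : θ.s = s := rfl
  have e3 : θ.ρ = 2 * p - 1 := rfl
  rw [Params.offset, e1, e2, e3]
  rw [ψ₂, ψ₃] at h
  linear_combination h

end Limit

/-! ### Convergence of the test loss -/

section Tail

variable {s p r lam : ℝ} {σ₁ : ℝ≥0} {n m D : ℕ}

theorem measurable_distBound (θ : Params) (lam : ℝ) (J : Fin n → Fin m) :
    Measurable (θ.distBound (D := D) lam J) := by
  unfold Params.distBound Params.errFt Params.errKnown Params.gradCore Params.gradNoise
    Params.noiseWeight Params.mainRes Params.resFt Params.resKnown
  fun_prop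

theorem distBound_nonneg (θ : Params) (hlam : 0 < lam) (J : Fin n → Fin m)
    (x : CoordIdx n m D → ℝ) : 0 ≤ θ.distBound lam J x := by
  unfold Params.distBound; positivity

/-- The constant in the tail bound. -/
def tailConst (s p r lam : ℝ) (σ₁ : ℝ≥0) : ℝ :=
  |(limitParams s p r lam σ₁).distConst lam r ((σ₁ : ℝ) ^ 2) (fourthBound σ₁)|

theorem measure_sq_dist_ge_le (hp : 1 / 2 < p) (hp1 : p ≤ 1) (hr : 0 < r) (hlam : 0 < lam)
    (hn : 0 < n) (hm : 0 < m) (hD : 0 < D) {σξ : ℝ≥0} (hσ : (σξ : ℝ) ^ 2 / m = r)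
    {Ω : Type*} [MeasurableSpace Ω] {P : Measure Ω} {T : Ω → Trial n (D + 2) m}
    (hT : HasLaw T (trialLaw n (D + 2) m σ₁ 0 σξ p) P) {w : Ω → Fin (D + 2) → ℝ}
    (hw : ∀ ω, IsMinOn (trainLoss s lam (T ω)) Set.univ (w ω)) {η : ℝ} (hη : 0 < η) :
    P {ω | η ≤ (w ω 0 - (limitParams s p r lam σ₁).a) ^ 2 +
        (w ω 1 - (limitParams s p r lam σ₁).b) ^ 2} ≤
      ENNReal.ofReal ((4 + 5 * (tailConst s p r lam σ₁ / η)) * (1 / m + m / D + m / n)) := by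
  have hm' : (0 : ℝ) < m := by positivity
  have hD' : (0 : ℝ) < D := by positivity
  have hn' : (0 : ℝ) < n := by positivity
  have hp' : p ∈ Set.Icc (0 : ℝ) 1 := ⟨by linarith, hp1⟩
  set θ := limitParams s p r lam σ₁ with hθ
  set C := tailConst s p r lam σ₁ with hC
  have hC0 : 0 ≤ C := abs_nonneg _
  have hdet := (limitDet_pos (s := s) (σ₁ := σ₁) hp hp1 hr hlam).ne'
  set τ : ℝ≥0 := σξ ^ 2 / (D : ℝ≥0) with hτ
  have i1 := fun k : CoordIdx n m D =>
    isProbabilityMeasure_sampleLaw (n := n) (m := m) σ₁ τ hp' k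
  have i2 := fun k : CoordIdx n m D => allMoments_sampleLaw (n := n) (m := m) σ₁ τ hp' k
  have hτ' : (D : ℝ) * (τ : ℝ) = r * m := by
    rw [hτ, ← hσ]; push_cast; field_simp
  let bad : (Fin n → Fin m) → Set (CoordIdx n m D → ℝ) := fun J => {x | η ≤ θ.distBound lam J x}
  have hbad : ∀ J, MeasurableSet (bad J) := fun J =>
    measurableSet_le measurable_const (measurable_distBound θ lam J)
  have hle : ∀ J, Measure.pi (sampleLaw n m D σ₁ τ p) (bad J) ≤
      ENNReal.ofReal (C / η * (m / D + m / n + 1 / m) + C / η * m * freqDev J) := by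
    intro J
    have hE := θ.integral_distBound_le (coordMoments_sampleLaw (n := n) (m := m) (D := D) σ₁ τ hp')
      hn hm hD (fourthBound_nonneg σ₁) hr hlam hτ' (limitParams_sq_noise hr hlam)
      (limitParams_ridge lam) (limitParams_stationary_fst hdet) (limitParams_stationary_snd hdet) J
    have hE0 : 0 ≤ (m : ℝ) / D + m / n + m * freqDev J + 1 / m := by
      have := freqDev_nonneg J
      positivity
    have hE' := hE.trans (mul_le_mul_of_nonneg_right (le_abs_self _) hE0)
    have hmk := mul_meas_ge_le_integral_of_nonneg
      (μ := Measure.pi (sampleLaw n m D σ₁ τ p)) (ae_of_all _ (distBound_nonneg θ hlam J))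
      (HasMoments.integrable (by unfold Params.distBound; fun_prop)) η
    rw [← ofReal_measureReal]
    refine ENNReal.ofReal_le_ofReal ?_
    have h1 : (Measure.pi (sampleLaw n m D σ₁ τ p)).real (bad J) ≤
        C * (m / D + m / n + m * freqDev J + 1 / m) / η := by
      rw [le_div_iff₀ hη, mul_comm]
      exact hmk.trans hE'
    refine h1.trans (le_of_eq ?_)
    ring
  have hmain := trialLaw_bad_le (D := D) hn hm σ₁ σξ hp' hbad (by positivity) (by positivity) hle
  have hsub : {ω | η ≤ (w ω 0 - θ.a) ^ 2 + (w ω 1 - θ.b) ^ 2} ⊆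
      T ⁻¹' {T | (¬ ∀ i, (T.1.2 (T.2 i)).label = (T.1.1 i).label) ∨
        (fun k : CoordIdx n m D => signedInputs T.1 k.1 k.2) ∈ bad T.2} := by
    intro ω hω
    by_cases h : ∀ i, ((T ω).1.2 ((T ω).2 i)).label = ((T ω).1.1 i).label
    · exact Or.inr (le_trans hω (sub_sq_add_sub_sq_le_distBound θ hlam (T ω) h (w ω) (hw ω)))
    · exact Or.inl h
  refine (measure_mono hsub).trans (((Measure.le_map_apply hT.aemeasurable _).trans
    (by rw [hT.map_eq]; exact hmain)).trans (ENNReal.ofReal_le_ofReal ?_))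
  have hx : 0 ≤ C / η := by positivity
  generalize C / η = x at *
  have e : 4 / (m : ℝ) + x * (m / D + m / n + 1 / m) + x * m * (1 / n + 4 / m ^ 2) =
      (4 + 5 * x) * (1 / m) + x * (m / D) + 2 * x * (m / n) := by
    field_simp; ring
  rw [e]
  have h1 : 0 ≤ (m : ℝ) / D := by positivity
  have h2 : 0 ≤ (m : ℝ) / n := by positivity
  nlinarith [mul_nonneg hx h1, mul_nonneg hx h2]

/-- Tail bound for the test loss at a fixed stage. -/
theorem measure_testLoss_dist_ge_le (hp : 1 / 2 < p) (hp1 : p ≤ 1) (hr : 0 < r)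
    (hlam : 0 < lam) {μ : ℝ} (hμ1 : μ < 1) {ε : ℝ} (hε : 0 < ε)
    {Ω : Type*} [MeasurableSpace Ω] {P : Measure Ω} :
    ∃ δ > 0, ∃ C : ℝ, 0 ≤ C ∧ ∀ (n d m : ℕ) (σξ : ℝ≥0) (T : Ω → Trial n d m)
      (w : Ω → Fin d → ℝ), 0 < n → 0 < m → 3 ≤ d → m ≤ d → (σξ : ℝ) ^ 2 / m = r →
      (m : ℝ) / d < δ → HasLaw T (trialLaw n d m σ₁ 0 σξ p) P →
      (∀ ω, IsMinOn (trainLoss s lam (T ω)) Set.univ (w ω)) →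
      P {ω | ε ≤ dist (testLoss d σ₁ 0 σξ μ (w ω)) (limitLoss s p r lam σ₁)} ≤
        ENNReal.ofReal (C * (1 / m + m / d + d / n)) := by
  set θ := limitParams s p r lam σ₁ with hθ
  let F : ℝ × ℝ × ℝ → ℝ := fun z => (z.1 - z.2.1 - 1) ^ 2 + (σ₁ : ℝ) ^ 2 * z.1 ^ 2 + z.2.2
  have hF : Continuous F := by fun_prop
  have hF0 : F (θ.a, θ.b, 0) = limitLoss s p r lam σ₁ := by
    rw [limitLoss_eq]; simp [F, hθ]
  obtain ⟨η, hη, hηF⟩ := Metric.continuous_iff.1 hF (θ.a, θ.b, 0) ε hε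
  refine ⟨η * lam / (3 * r), by positivity, 3 * (4 + 5 * (tailConst s p r lam σ₁ / η ^ 2)),
    by have : 0 ≤ tailConst s p r lam σ₁ := abs_nonneg _; positivity, ?_⟩
  intro n d m σξ T w hn hm hd hmd hσ hδ hT hw
  obtain ⟨D, rfl⟩ : ∃ D, d = D + 2 := ⟨d - 2, by omega⟩
  have hD : 0 < D := by omega
  have hD' : (1 : ℝ) ≤ D := by exact_mod_cast hD
  have hm' : (0 : ℝ) < m := by positivity
  have hn' : (0 : ℝ) < n := by positivity
  have hmD : (m : ℝ) / D ≤ 3 * (m / (D + 2 : ℕ)) := by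
    push_cast
    rw [← mul_div_assoc, div_le_div_iff₀ (by linarith) (by linarith)]
    nlinarith
  have hsub : {ω | ε ≤ dist (testLoss (D + 2) σ₁ 0 σξ μ (w ω)) (limitLoss s p r lam σ₁)} ⊆
      {ω | η ^ 2 ≤ (w ω 0 - θ.a) ^ 2 + (w ω 1 - θ.b) ^ 2} := by
    intro ω hω
    by_contra hlt
    simp only [Set.mem_ofPred_eq, not_le] at hlt
    refine absurd (Set.mem_ofPred_eq ▸ hω : ε ≤ _) (not_le.2 ?_)
    have ha : |w ω 0 - θ.a| < η := by
      refine lt_of_pow_lt_pow_left₀ 2 hη.le ?_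
      rw [sq_abs]; nlinarith [sq_nonneg (w ω 1 - θ.b)]
    have hb : |w ω 1 - θ.b| < η := by
      refine lt_of_pow_lt_pow_left₀ 2 hη.le ?_
      rw [sq_abs]; nlinarith [sq_nonneg (w ω 0 - θ.a)]
    have hsum : ∑ l : Fin D, w ω l.succ.succ ^ 2 ≤ 1 / lam := by
      refine le_trans ?_ (sum_sq_le_of_isMinOn hlam (T ω) (w ω) (hw ω))
      rw [Fin.sum_univ_succ, Fin.sum_univ_succ]
      nlinarith [sq_nonneg (w ω 0), sq_nonneg (w ω (Fin.succ 0))]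
    have hτ : (σξ : ℝ) ^ 2 / D = r * (m / D) := by rw [← hσ]; field_simp
    have hc : |(σξ : ℝ) ^ 2 / D * ∑ l : Fin D, w ω l.succ.succ ^ 2| < η := by
      rw [abs_of_nonneg (by positivity), hτ]
      calc r * (m / D) * ∑ l : Fin D, w ω l.succ.succ ^ 2
          ≤ r * (3 * (m / (D + 2 : ℕ))) * (1 / lam) := by gcongr
        _ < r * (3 * (η * lam / (3 * r))) * (1 / lam) := by gcongr
        _ = η := by field_simp
    rw [testLoss_eq _ _ _ hμ1, ← hF0]
    refine hηF (w ω 0, w ω 1, (σξ : ℝ) ^ 2 / D * ∑ l : Fin D, w ω l.succ.succ ^ 2) ?_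
    simp only [Prod.dist_eq, max_lt_iff, Real.dist_eq, sub_zero]
    exact ⟨ha, hb, hc⟩
  refine (measure_mono hsub).trans ((measure_sq_dist_ge_le hp hp1 hr hlam hn hm hD hσ hT hw
    (by positivity)).trans (ENNReal.ofReal_le_ofReal ?_))
  have hC : 0 ≤ 4 + 5 * (tailConst s p r lam σ₁ / η ^ 2) := by
    have : 0 ≤ tailConst s p r lam σ₁ := abs_nonneg _
    positivity
  have hmn : (m : ℝ) / n ≤ (D + 2 : ℕ) / n := by
    gcongr
  have h1 : 0 ≤ 1 / (m : ℝ) := by positivity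
  have h2 : 0 ≤ ((D + 2 : ℕ) : ℝ) / n := by positivity
  rw [mul_comm 3, mul_assoc]
  refine mul_le_mul_of_nonneg_left ?_ hC
  linarith

end Tail

end

end Dispel

theorem theorem1 (s p r lam μ : ℝ) (σ₁ : ℝ≥0)
    (hs : s ∈ Set.Icc (0 : ℝ) 1) (hp : 1 / 2 < p) (hp1 : p ≤ 1) (hr : 0 < r) (hlam : 0 < lam)
    (hμ : 0 ≤ μ) (hμ1 : μ < 1)
    -- sample sizes, dimension and noise level along the asymptotic regime
    (n d m : ℕ → ℕ) (σξ : ℕ → ℝ≥0)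
    (hn : Tendsto n atTop atTop) (hd : Tendsto d atTop atTop) (hm : Tendsto m atTop atTop)
    (hnd : Tendsto (fun k => (n k : ℝ) / d k) atTop atTop)
    (hdm : Tendsto (fun k => (d k : ℝ) / m k) atTop atTop)
    (hσ : ∀ k, (σξ k : ℝ) ^ 2 / m k = r)
    -- the training runs; nothing is assumed on their joint law for different `k`
    {Ω : Type*} [MeasurableSpace Ω] (P : Measure Ω) [IsProbabilityMeasure P]
    (T : ∀ k, Ω → Dispel.Trial (n k) (d k) (m k))
    (hT : ∀ k, HasLaw (T k) (Dispel.trialLaw (n k) (d k) (m k) σ₁ 0 (σξ k) p) P)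
    -- the trained weights
    (w : ∀ k, Ω → Fin (d k) → ℝ)
    (hw : ∀ k ω, IsMinOn (Dispel.trainLoss s lam (T k ω)) Set.univ (w k ω)) :
    TendstoInMeasure P (fun k ω => Dispel.testLoss (d k) σ₁ 0 (σξ k) μ (w k ω)) atTop
        (fun _ => Dispel.limitLoss s p r lam σ₁) ∧
      (Summable (fun k => 1 / (m k : ℝ) + (m k : ℝ) / d k + (d k : ℝ) / n k) →
        ∀ᵐ ω ∂P, Tendsto (fun k => Dispel.testLoss (d k) σ₁ 0 (σξ k) μ (w k ω)) atTop
          (𝓝 (Dispel.limitLoss s p r lam σ₁))) := by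
  have hmd0 : Tendsto (fun k => (m k : ℝ) / d k) atTop (𝓝 0) := by
    simpa [Pi.inv_def] using hdm.inv_tendsto_atTop
  have hdn0 : Tendsto (fun k => (d k : ℝ) / n k) atTop (𝓝 0) := by
    simpa [Pi.inv_def] using hnd.inv_tendsto_atTop
  have hm0 : Tendsto (fun k => 1 / (m k : ℝ)) atTop (𝓝 0) := by
    simpa [Pi.inv_def] using (tendsto_natCast_atTop_atTop.comp hm).inv_tendsto_atTop
  have hrate : Tendsto (fun k => 1 / (m k : ℝ) + (m k : ℝ) / d k + (d k : ℝ) / n k) atTop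
      (𝓝 0) := by simpa using (hm0.add hmd0).add hdn0
  have htail : ∀ ε > 0, ∃ C : ℝ, 0 ≤ C ∧ ∀ᶠ k in atTop,
      P {ω | ε ≤ dist (Dispel.testLoss (d k) σ₁ 0 (σξ k) μ (w k ω))
        (Dispel.limitLoss s p r lam σ₁)} ≤
      ENNReal.ofReal (C * (1 / (m k : ℝ) + (m k : ℝ) / d k + (d k : ℝ) / n k)) := by
    intro ε hε
    obtain ⟨δ, hδ, C, hC, h⟩ := Dispel.measure_testLoss_dist_ge_le (s := s) (σ₁ := σ₁) (P := P)
      hp hp1 hr hlam hμ1 hε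
    refine ⟨C, hC, ?_⟩
    filter_upwards [hn.eventually_gt_atTop 0, hm.eventually_gt_atTop 0, hd.eventually_ge_atTop 3,
      hdm.eventually_ge_atTop 1, hmd0.eventually_lt_const hδ] with k h1 h2 h3 h4 h5
    refine h _ _ _ _ _ _ h1 h2 h3 ?_ (hσ k) h5 (hT k) (hw k)
    have h2' : (0 : ℝ) < m k := by exact_mod_cast h2
    rw [le_div_iff₀ h2', one_mul] at h4
    exact_mod_cast h4
  refine ⟨?_, fun hsum => ?_⟩
  · rw [tendstoInMeasure_iff_dist]
    intro ε hε
    obtain ⟨C, -, hC⟩ := htail ε hε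
    refine tendsto_of_tendsto_of_tendsto_of_le_of_le' tendsto_const_nhds ?_
      (Eventually.of_forall fun _ => zero_le) hC
    simpa using ENNReal.tendsto_ofReal (hrate.const_mul C)
  · have hae : ∀ j : ℕ, ∀ᵐ ω ∂P, ∀ᶠ k in atTop,
        dist (Dispel.testLoss (d k) σ₁ 0 (σξ k) μ (w k ω)) (Dispel.limitLoss s p r lam σ₁) <
          1 / ((j : ℝ) + 1) := by
      intro j
      obtain ⟨C, -, hC⟩ := htail (1 / ((j : ℝ) + 1)) (by positivity)
      obtain ⟨k₀, hk₀⟩ := eventually_atTop.1 hC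
      have hfin : ∑' k, P (if k₀ ≤ k then
          {ω | 1 / ((j : ℝ) + 1) ≤ dist (Dispel.testLoss (d k) σ₁ 0 (σξ k) μ (w k ω))
            (Dispel.limitLoss s p r lam σ₁)} else ∅) ≠ ∞ := by
        refine ne_top_of_le_ne_top (hsum.mul_left C).tsum_ofReal_ne_top
          (ENNReal.tsum_le_tsum fun k => ?_)
        split_ifs with hk
        · exact hk₀ k hk
        · simp
      filter_upwards [ae_eventually_notMem hfin] with ω hω
      filter_upwards [hω, eventually_ge_atTop k₀] with k h1 h2
      rw [if_pos h2] at h1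
      simpa using h1
    filter_upwards [ae_all_iff.2 hae] with ω hω
    rw [Metric.tendsto_nhds]
    intro ε hε
    obtain ⟨j, hj⟩ := exists_nat_one_div_lt hε
    exact (hω j).mono fun k hk => hk.trans hj
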